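/- Let $\mathrm{Rat}_1$ be the space of rational maps $W(z)=\frac{a_1z+a_2}{a_3z+a_4}$, $a_1a_4-a_2a_3\neq0$, identified with $PL(2,\mathbb C)=GL(2,\mathbb C)/\mathbb C^\times$ (write $[L]$ for the class of the coefficient matrix $L$) with the complex structure of an open subset of $\mathbb{CP}^3$, and let $SO(3)\times SO(3)\cong PU(2)\times PU(2)$ act by $([U_1],[U_2])\cdot[L]=[U_1LU_2^{-1}]$. Let $\tau_1,\tau_2,\tau_3$ be the Pauli matrices. For $\boldsymbol\lambda\in\mathbb R^3$ put $\lambda=|\boldsymbol\lambda|$ and $\Lambda=\sqrt{1+\lambda^2}$; the polar decomposition $([U],\boldsymbol\lambda)\mapsto[U(\Lambda\mathbb I_2+\boldsymbol\lambda\cdot\boldsymbol\tau)]$ identifies $PU(2)\times\mathbb R^3\cong SO(3)\times\mathbb R^3$ with $\mathrm{Rat}_1$. Let $\boldsymbol\theta=(\theta_1,\theta_2,\theta_3)$ be the left-invariant vector fields on $PU(2)$ equal to $\frac i2\tau_a$ at the identity, let $\boldsymbol\partial=(\partial/\partial\lambda_1,\partial/\partial\lambda_2,\partial/\partial\lambda_3)$,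 and let $\partial/\partial\lambda$ be the radial derivative on $\mathbb R^3\setminus\{0\}$. Let $\gamma$ be an $SO(3)\times SO(3)$-invariant (smooth) Kähler metric on $\mathrm{Rat}_1$, let $A(\lambda)$ be the squared $\gamma$-length of $\partial/\partial\lambda_1$ at the point $([\mathbb I_2],(0,0,\lambda))$, and let $$B=\tfrac14(\lambda^2+\Lambda^2)A+\tfrac14\lambda\Lambda^2A'.$$ Let $\triangle=-{*}d{*}d$ be the Laplacian of $(\mathrm{Rat}_1,\gamma)$ on functions. Then for every $C^2$ function $f:\mathrm{Rat}_1\to\mathbb R$, at every point with $\boldsymbol\lambda\neq0$, $$\begin{aligned}\triangle f={}&-\frac{4}{\Lambda^2A}\Big\{\boldsymbol\theta\cdot\boldsymbol\theta f+\boldsymbol\lambda\cdot(\boldsymbol\partial\times\boldsymbol\theta)f-\frac1{\lambda^2}\Big[1-\frac{\Lambda^2A}{4B}\Big](\boldsymbol\lambda\cdot\boldsymbol\theta)^2f\Big\}\\&-\frac{1}{\Lambda\lambda^2A^2B}\frac{\partial}{\partial\lambda}\Big(\frac{\lambda^2\Lambda^3A^2}{4}\frac{\partial f}{\partial\lambda}\Big)-\frac{\Lambda^2+\lambda^2}{\lambda^2\Lambda^2A}(\boldsymbol\lambda\times\boldsymbol\partial)\cdot(\boldsymbol\lambda\times\boldsymbol\partial)f,\end{aligned}$$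 and at a point $([U],0)$ the value of $\triangle f$ is the limit of the right-hand side at $([U],\boldsymbol\lambda)$ as $\boldsymbol\lambda\to0$, $\boldsymbol\lambda\ne0$. -/

import Mathlib

open Topology Filter

open scoped Matrix

noncomputable section

/-- Complex `2 × 2` matrices. -/
abbrev Mat2 := Matrix (Fin 2) (Fin 2) ℂ

/-- A function of an invertible matrix is of class `C^n`, as a function of the four entries. -/
def IsCnOnGL (n : ℕ∞) (u : Mat2 → ℝ) : Prop :=
  ContDiffOn ℝ n (fun v : Fin 2 → Fin 2 → ℂ => u (Matrix.of v)) {v | (Matrix.of v).det ≠ 0}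

/-- The group `SU(2)`. -/
abbrev SU2 := Matrix.specialUnitaryGroup (Fin 2) ℂ

/-! ### The space of rational maps of degree one -/

/-- `Rat₁`: the rational maps `W(z) = (a₁ z + a₂) / (a₃ z + a₄)` with `a₁ a₄ - a₂ a₃ ≠ 0`, as
self-maps of the Riemann sphere `ℂ ∪ {∞}`. -/
def Rat1 : Type :=
  {W : OnePoint ℂ → OnePoint ℂ // ∃ L : GL (Fin 2) ℂ, ∀ z, W z = L • z}

namespace Rat1

/-- The rational map `[L]` whose coefficients are the entries of `L`. -/
def mk (L : GL (Fin 2) ℂ) : Rat1 := ⟨fun z => L • z, L, fun _ => rfl⟩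

/-- The rational map `[L]`, for a matrix `L` with nonzero determinant. -/
def ofMatrix (L : Mat2) (h : L.det ≠ 0) : Rat1 :=
  mk (Matrix.GeneralLinearGroup.mkOfDetNeZero L h)

/-- A matrix that represents a given rational map (it is unique up to a nonzero factor). -/
def rep (W : Rat1) : Mat2 := (W.2.choose : GL (Fin 2) ℂ)

open Classical in
/-- The pull-back `L ↦ f([L])` of a function on `Rat₁` to the open set of invertible matrices
(extended by `0` to the singular ones, where it is never used). -/
def pullback (f : Rat1 → ℝ) (L : Mat2) : ℝ := if h : L.det ≠ 0 then f (ofMatrix L h) else 0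

/-- `f` is of class `C^n` on `Rat₁ = GL(2,ℂ) / ℂ^×`: its pull-back to the invertible matrices is.
(The projection is a surjective submersion.) -/
def IsCn (n : ℕ∞) (f : Rat1 → ℝ) : Prop :=
  IsCnOnGL n (pullback f)

end Rat1

/-- A smooth Riemannian metric on `Rat₁ = GL(2,ℂ) / ℂ^×`. The tangent space of `Rat₁` at `[L]` is
the quotient of the space of matrices by the line `ℂ L`, and `(L, X)`, `(c L, c X)` represent the
same tangent vector. `val L X Y` is the inner product of the tangent vectors at `[L]` which are
represented by `X` and `Y`. -/
structure RatMetric where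
  val : Mat2 → Mat2 →ₗ[ℝ] Mat2 →ₗ[ℝ] ℝ
  smooth : ∀ X Y, IsCnOnGL ⊤ (fun L => val L X Y)
  symm : ∀ L : Mat2, L.det ≠ 0 → ∀ X Y, val L X Y = val L Y X
  scale : ∀ L : Mat2, L.det ≠ 0 → ∀ c : ℂ, c ≠ 0 → ∀ X Y,
    val (c • L) (c • X) (c • Y) = val L X Y
  vertical : ∀ L : Mat2, L.det ≠ 0 → ∀ (c : ℂ) (Y : Mat2), val L (c • L) Y = 0
  pos : ∀ L : Mat2, L.det ≠ 0 → ∀ X : Mat2, (∀ c : ℂ, X ≠ c • L) → 0 < val L X X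

/-- Laplacian `-* d * d f` of a function `f` at the point `x`, in local coordinates in which the
metric has the Gram matrix `g`:
`- |g|^{-1/2} ∑ᵢⱼ ∂ᵢ (|g|^{1/2} gⁱʲ ∂ⱼ f)`. -/
def coordLaplacian {ι : Type*} [Fintype ι] [DecidableEq ι]
    (g : (ι → ℝ) → Matrix ι ι ℝ) (f : (ι → ℝ) → ℝ) (x : ι → ℝ) : ℝ :=
  -(1 / √(g x).det) * ∑ i, ∑ j,
    fderiv ℝ (fun y => √(g y).det * (g y)⁻¹ i j * fderiv ℝ f y (Pi.single j 1)) x (Pi.single i 1)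

/-- The Pauli matrices. -/
def pauli : Fin 3 → Mat2 :=
  ![!![0, 1; 1, 0], !![0, -Complex.I; Complex.I, 0], !![1, 0; 0, -1]]

/-- Coordinate directions `τ_a`, `i τ_a`, for the real and imaginary parts of `z ∈ ℂ³`. -/
def chartDir : Fin 3 ⊕ Fin 3 → Mat2 :=
  Sum.elim pauli (fun a => Complex.I • pauli a)

/-- Affine coordinates of `Rat₁ ⊆ ℂP³` centred at `[L]`: the point with complex coordinates
`z = x + i y ∈ ℂ³` is `[L (1 + z · τ)]`. The map `z ↦ [L (1 + z · τ)]` does not change if `L` is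
multiplied by a nonzero number. -/
def affineChart (L : Mat2) (x : Fin 3 ⊕ Fin 3 → ℝ) : Mat2 :=
  L * (1 + ∑ i, x i • chartDir i)

namespace RatMetric

/-- Invariance under `SO(3) × SO(3)`, that is, under `PU(2) × PU(2)` acting by
`[L] ↦ [U₁ L U₂⁻¹]`. -/
def IsInvariant (γ : RatMetric) : Prop :=
  ∀ (U₁ U₂ : SU2) (L : Mat2), L.det ≠ 0 → ∀ X Y : Mat2,
    γ.val (U₁.1 * L * (U₂⁻¹).1) (U₁.1 * X * (U₂⁻¹).1) (U₁.1 * Y * (U₂⁻¹).1) = γ.val L X Y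

/-- The derivative at `L`, in the direction `X`, of the coefficient `ω(Y, Z)` of the fundamental
form `ω(Y, Z) = γ(i Y, Z)`, pulled back to the invertible matrices; here `Y`, `Z` are constant
vector fields. -/
def dirDerivForm (γ : RatMetric) (L X Y Z : Mat2) : ℝ :=
  deriv (fun t : ℝ => γ.val (L + t • X) (Complex.I • Y) Z) 0

/-- `γ` is Kähler: it is Hermitian and its fundamental form is closed, for the complex structure
which `Rat₁` has as an open subset of `ℂP³`. (A form on `Rat₁` is closed if and only if its
pull-back to the open set of invertible matrices is.) -/
def IsKahler (γ : RatMetric) : Prop :=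
  (∀ L : Mat2, L.det ≠ 0 → ∀ X Y,
    γ.val L (Complex.I • X) (Complex.I • Y) = γ.val L X Y) ∧
  (∀ L : Mat2, L.det ≠ 0 → ∀ X Y Z,
    γ.dirDerivForm L X Y Z + γ.dirDerivForm L Y Z X + γ.dirDerivForm L Z X Y = 0)

/-- Gram matrix of `γ` in the affine coordinates centred at `[L]`. -/
def chartGram (γ : RatMetric) (L : Mat2) (x : Fin 3 ⊕ Fin 3 → ℝ) :
    Matrix (Fin 3 ⊕ Fin 3) (Fin 3 ⊕ Fin 3) ℝ :=
  Matrix.of fun i j => γ.val (affineChart L x) (L * chartDir i) (L * chartDir j)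

/-- The Laplacian of `(Rat₁, γ)` on functions (the nonnegative one, `-* d * d`), computed at
each point in the affine coordinates centred at that point. -/
def laplacian (γ : RatMetric) (f : Rat1 → ℝ) (W : Rat1) : ℝ :=
  coordLaplacian (γ.chartGram W.rep) (fun x => Rat1.pullback f (affineChart W.rep x)) 0

end RatMetric

/-! ### Polar coordinates `Rat₁ ≅ PU(2) × ℝ³` -/

/-- `λ = |𝛌|`. -/
def len (l : Fin 3 → ℝ) : ℝ := √(l ⬝ᵥ l)

/-- `Λ = √(1 + λ²)`. -/
def capLam (s : ℝ) : ℝ := √(1 + s ^ 2)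

/-- The positive matrix `Λ 1 + 𝛌 · τ`. -/
def boost (l : Fin 3 → ℝ) : Mat2 := capLam (len l) • (1 : Mat2) + ∑ a, l a • pauli a

theorem det_boost (l : Fin 3 → ℝ) : (boost l).det = 1 := by
  have h0 : 0 ≤ l ⬝ᵥ l := by
    simp only [dotProduct, Fin.sum_univ_three]
    nlinarith [mul_self_nonneg (l 0), mul_self_nonneg (l 1), mul_self_nonneg (l 2)]
  have h : capLam (len l) ^ 2 = 1 + (l 0 * l 0 + l 1 * l 1 + l 2 * l 2) := by
    rw [capLam, len, Real.sq_sqrt (by positivity), Real.sq_sqrt h0]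
    simp [dotProduct, Fin.sum_univ_three]
  have h' : (capLam (len l) : ℂ) ^ 2 = 1 + ((l 0 : ℂ) * l 0 + l 1 * l 1 + l 2 * l 2) := by
    exact_mod_cast congrArg (fun x : ℝ => (x : ℂ)) h
  simp [boost, pauli, Fin.sum_univ_three, Matrix.det_fin_two]
  linear_combination h' + (l 1 : ℂ) ^ 2 * Complex.I_sq

theorem det_polar (U : SU2) (l : Fin 3 → ℝ) : (U.1 * boost l).det ≠ 0 := by
  rw [Matrix.det_mul, det_boost, (Matrix.mem_specialUnitaryGroup_iff.1 U.2).2]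
  simp

/-- The point `[U (Λ 1 + 𝛌 · τ)]` of `Rat₁`. It depends on `U` only through `[U] ∈ PU(2)`. -/
def polar (U : SU2) (l : Fin 3 → ℝ) : Rat1 := Rat1.ofMatrix (U.1 * boost l) (det_polar U l)

/-- `exp (t (i/2) τ_a) = cos (t/2) + i sin (t/2) τ_a`. -/
def oneParam (a : Fin 3) (t : ℝ) : SU2 :=
  ⟨Real.cos (t / 2) • (1 : Mat2) + ((Real.sin (t / 2) : ℂ) * Complex.I) • pauli a, by
    have h : (Complex.cos (t / 2)) ^ 2 + (Complex.sin (t / 2)) ^ 2 = 1 := by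
      rw [add_comm]; exact Complex.sin_sq_add_cos_sq _
    have hr : (starRingEnd ℂ) ((t : ℂ) / 2) = t / 2 := by
      rw [map_div₀, Complex.conj_ofReal, Complex.conj_ofNat]
    have hs : (starRingEnd ℂ) (Complex.sin (t / 2)) = Complex.sin (t / 2) := by
      rw [← Complex.sin_conj, hr]
    have hI := Complex.I_sq
    rw [Matrix.mem_specialUnitaryGroup_iff]
    constructor
    · rw [Matrix.mem_unitaryGroup_iff]
      ext i j
      fin_cases a <;> fin_cases i <;> fin_cases j <;>
        simp [pauli, Matrix.mul_apply, Fin.sum_univ_two, hs] <;> ring_nf <;>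
        simp [Complex.I_sq]
    · fin_cases a <;> simp [pauli, Matrix.det_fin_two] <;> grind⟩

/-! ### Differential operators on functions on `PU(2) × ℝ³`

Functions on `PU(2) × ℝ³` are written as functions on `SU(2) × ℝ³`. -/

/-- The left-invariant vector field `θ_a`, which is `(i/2) τ_a` at the identity. -/
def thetaD (a : Fin 3) (F : SU2 → (Fin 3 → ℝ) → ℝ) : SU2 → (Fin 3 → ℝ) → ℝ :=
  fun U l => deriv (fun t : ℝ => F (U * oneParam a t) l) 0

/-- `∂_a = ∂/∂λ_a`. -/
def partialD (a : Fin 3) (F : SU2 → (Fin 3 → ℝ) → ℝ) : SU2 → (Fin 3 → ℝ) → ℝ :=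
  fun U l => deriv (fun t : ℝ => F U (l + t • Pi.single a 1)) 0

/-- `∂/∂λ`, the derivative along the ray through `𝛌`, with respect to `λ = |𝛌|`. -/
def radialD (F : SU2 → (Fin 3 → ℝ) → ℝ) : SU2 → (Fin 3 → ℝ) → ℝ :=
  fun U l => deriv (fun s : ℝ => F U (s • ((len l)⁻¹ • l))) (len l)

/-- The components of `𝛌 × ∂`. -/
def angularD (a : Fin 3) (F : SU2 → (Fin 3 → ℝ) → ℝ) : SU2 → (Fin 3 → ℝ) → ℝ :=
  fun U l => (l ⨯₃ (fun b => partialD b F U l)) a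

/-- `𝛌 · θ`. -/
def lamTheta (F : SU2 → (Fin 3 → ℝ) → ℝ) : SU2 → (Fin 3 → ℝ) → ℝ :=
  fun U l => ∑ a, l a * thetaD a F U l

/-- `𝛌 · (∂ × θ)`. -/
def lamPartialTheta (F : SU2 → (Fin 3 → ℝ) → ℝ) : SU2 → (Fin 3 → ℝ) → ℝ :=
  fun U l => l ⬝ᵥ ![partialD 1 (thetaD 2 F) U l - partialD 2 (thetaD 1 F) U l,
    partialD 2 (thetaD 0 F) U l - partialD 0 (thetaD 2 F) U l,
    partialD 0 (thetaD 1 F) U l - partialD 1 (thetaD 0 F) U l]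

/-- A matrix that represents the tangent vector `∂/∂λ₁` at the point `([1], (0, 0, s))`: the
velocity of `t ↦ Λ 1 + 𝛌(t) · τ` with `𝛌(t) = (t, 0, s)`. -/
def velocity (s : ℝ) : Mat2 := Matrix.of fun i j => deriv (fun t : ℝ => boost ![t, 0, s] i j) 0

/-- The function `A` that determines an invariant Kähler metric: `A(s)` is the squared length of
`∂/∂λ₁` at the point `([1], (0, 0, s))`. -/
def RatMetric.A (γ : RatMetric) (s : ℝ) : ℝ :=
  γ.val (boost ![0, 0, s]) (velocity s) (velocity s)

/-- `B = (λ² + Λ²) A / 4 + λ Λ² A' / 4`. -/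
def coeffB (A : ℝ → ℝ) (s : ℝ) : ℝ :=
  1 / 4 * (s ^ 2 + capLam s ^ 2) * A s + 1 / 4 * s * capLam s ^ 2 * deriv A s

/-- The second-order operator determined by the function `A`, with `B` as in `coeffB`, at points
with `𝛌 ≠ 0`:
`-4/(Λ² A) {θ·θ + 𝛌·(∂ × θ) - λ⁻² [1 - Λ² A/(4 B)] (𝛌·θ)²}
  - 1/(Λ λ² A² B) ∂/∂λ (λ² Λ³ A²/4 ∂/∂λ) - (Λ² + λ²)/(λ² Λ² A) (𝛌 × ∂)·(𝛌 × ∂)`. -/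
def lapFormula (A : ℝ → ℝ) (F : SU2 → (Fin 3 → ℝ) → ℝ) (U : SU2) (l : Fin 3 → ℝ) : ℝ :=
  let s := len l;
  let B := coeffB A;
  -(4 / (capLam s ^ 2 * A s)) *
      ((∑ a, thetaD a (thetaD a F) U l) + lamPartialTheta F U l
        - 1 / s ^ 2 * (1 - capLam s ^ 2 * A s / (4 * B s)) * lamTheta (lamTheta F) U l)
    - 1 / (capLam s * s ^ 2 * A s ^ 2 * B s) *
        radialD (fun V m => len m ^ 2 * capLam (len m) ^ 3 * A (len m) ^ 2 / 4 * radialD F V m) U l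
    - (capLam s ^ 2 + s ^ 2) / (s ^ 2 * capLam s ^ 2 * A s) *
        (∑ a, angularD a (angularD a F) U l)

end

noncomputable section

/-! ### The Laplacian in coordinates which are harmonic at a point -/

section CoordLaplacian

variable {ι E : Type*} [Fintype ι] [DecidableEq ι] [NormedAddCommGroup E] [NormedSpace ℝ E]

/-! On a Kähler manifold holomorphic coordinates are harmonic. In the affine chart `x ↦ L (1 + z ·
τ)` the Laplacian at the centre therefore loses its first-order part and becomes minus the metric
trace of the second derivative of the pulled-back function; as the chart is affine, this is a trace
of the Hessian on the matrix space itself (`lapAt`). The hypothesis `dω = 0` enters here for the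
first time (`IsKahler.sum_inv_gram_dform`).

It enters a second time to determine the metric. For the generators of the two actions, closedness
and invariance give `ω([ξ, ξ'], η) = 0` with `ξ, ξ'` left and `η` right; since `su(2)` is perfect,
left and right orbits are `ω`-orthogonal (`IsKahler.val_gen_right`). At a point of the third axis
this expresses every component in terms of `A`, except the radial one. The radial one is found by
differentiating `ω(ξ₁, ξ₂) = Λ λ A / 2` along the axis: by the moment-map identity the result is a
multiple of the squared radial length, which comes out as `4B`. Rotations carry the result to every
`𝛌 ≠ 0`, and the Gram matrix is inverted inside the algebra spanned by `1`, `𝛌 𝛌ᵀ` and the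
cross-product matrix (`IsKahler.inv_gram_polar`).

It remains to compare two explicit operators. With `P = boost l`, all fields in the formula are
expanded in the frame `P τ_a`, `i P τ_a`. The Hessian terms agree by a purely algebraic identity
(`trace_identity`). In the first-order terms the differential `D` of `u` is evaluated on `P`, `τ(𝛌)`
and `1` only; scale invariance gives `D P = 0`, that is `D τ(𝛌) = -Λ D 1`, and the definition of `B`
makes the remaining multiples of `D 1` cancel (`scalar_identity`). At `𝛌 = 0` the claim follows
because the trace form is continuous on all invertible matrices. -/

theorem Matrix.sum_det_updateRow (M N : Matrix ι ι ℝ) :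
    ∑ i, (M.updateRow i fun j => N i j).det = ∑ i, ∑ j, M.adjugate j i * N i j := by
  refine Finset.sum_congr rfl fun i _ => ?_
  rw [← Matrix.cramer_transpose_apply, Matrix.cramer_eq_adjugate_mulVec, ← Matrix.adjugate_transpose]
  rfl

/-- Jacobi's formula. -/
theorem hasFDerivAt_matrix_det {M : E → Matrix ι ι ℝ} {M' : ι → ι → E →L[ℝ] ℝ} {x : E}
    (h : ∀ i j, HasFDerivAt (fun y => M y i j) (M' i j) x) :
    HasFDerivAt (fun y => (M y).det) (∑ i, ∑ j, (M x).adjugate j i • M' i j) x := by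
  let D : ContinuousMultilinearMap ℝ (fun _ : ι => ι → ℝ) ℝ :=
    ⟨(Matrix.detRowAlternating (R := ℝ) (n := ι)).toMultilinearMap, by
      exact Continuous.matrix_det (A := fun M : ι → ι → ℝ => Matrix.of M) continuous_id⟩
  have hM : HasFDerivAt (fun y => (M y : ι → ι → ℝ))
      (ContinuousLinearMap.pi fun i => ContinuousLinearMap.pi fun j => M' i j) x :=
    hasFDerivAt_pi.2 fun i => hasFDerivAt_pi.2 fun j => h i j
  have key := (D.hasFDerivAt (M x)).comp x hM
  refine key.congr_fderiv ?_
  ext v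
  refine (ContinuousMultilinearMap.linearDeriv_apply D _ _).trans ?_
  simp only [_root_.sum_apply, _root_.smul_apply, smul_eq_mul]
  exact Matrix.sum_det_updateRow (M x) (fun i j => M' i j v)

theorem differentiableAt_matrix_det {M : E → Matrix ι ι ℝ} {x : E}
    (h : ∀ i j, DifferentiableAt ℝ (fun y => M y i j) x) :
    DifferentiableAt ℝ (fun y => (M y).det) x :=
  (hasFDerivAt_matrix_det fun i j => (h i j).hasFDerivAt).differentiableAt

theorem differentiableAt_matrix_inv {M : E → Matrix ι ι ℝ} {x : E}
    (h : ∀ i j, DifferentiableAt ℝ (fun y => M y i j) x) (hx : (M x).det ≠ 0) (i j : ι) :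
    DifferentiableAt ℝ (fun y => (M y)⁻¹ i j) x := by
  simp only [Matrix.inv_def, Ring.inverse_eq_inv', Matrix.smul_apply, smul_eq_mul,
    Matrix.adjugate_apply]
  refine ((differentiableAt_matrix_det h).inv hx).mul (differentiableAt_matrix_det fun k l => ?_)
  by_cases hk : k = j
  · subst hk
    simp
  · simpa [Matrix.updateRow_ne hk] using h k l

theorem fderiv_matrix_inv {M : E → Matrix ι ι ℝ} {x : E}
    (h : ∀ i j, DifferentiableAt ℝ (fun y => M y i j) x) (hx : (M x).det ≠ 0) (i j : ι) (v : E) :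
    fderiv ℝ (fun y => (M y)⁻¹ i j) x v =
      -∑ a, ∑ b, (M x)⁻¹ i a * fderiv ℝ (fun y => M y a b) x v * (M x)⁻¹ b j := by
  have hN := differentiableAt_matrix_inv h hx
  set N' : Matrix ι ι ℝ := Matrix.of fun i j => fderiv ℝ (fun y => (M y)⁻¹ i j) x v with hN'
  set M' : Matrix ι ι ℝ := Matrix.of fun i j => fderiv ℝ (fun y => M y i j) x v with hM'
  -- This is the derivative of `M⁻¹ M = 1`, an identity valid near `x` because `det ≠ 0` is an open
  -- condition.
  have hprod : N' * M x + (M x)⁻¹ * M' = 0 := by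
    ext k l
    have hev : (fun y => ∑ a, (M y)⁻¹ k a * M y a l) =ᶠ[𝓝 x]
        fun _ => (1 : Matrix ι ι ℝ) k l := by
      filter_upwards [(differentiableAt_matrix_det h).continuousAt.eventually_ne hx] with y hy
      rw [← Matrix.nonsing_inv_mul (M y) (Ne.isUnit hy), Matrix.mul_apply]
    have h1 : HasFDerivAt (fun y => ∑ a, (M y)⁻¹ k a * M y a l) _ x :=
      HasFDerivAt.fun_sum fun a _ => (hN k a).hasFDerivAt.mul (h a l).hasFDerivAt
    have h2 := (h1.congr_of_eventuallyEq hev.symm).unique (hasFDerivAt_const _ x)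
    have h3 := congrArg (fun φ : E →L[ℝ] ℝ => φ v) h2
    simp only [_root_.sum_apply, _root_.add_apply,
      _root_.smul_apply, smul_eq_mul, Finset.sum_add_distrib,
      _root_.zero_apply] at h3
    simp only [Matrix.add_apply, Matrix.mul_apply, Matrix.zero_apply, hN', hM', Matrix.of_apply]
    rw [add_comm, ← h3]
    congr 1
    exact Finset.sum_congr rfl fun a _ => mul_comm _ _
  have hu : IsUnit (M x).det := Ne.isUnit hx
  have : N' = -((M x)⁻¹ * M' * (M x)⁻¹) := by
    rw [← Matrix.mul_nonsing_inv_cancel_right _ N' hu, eq_neg_of_add_eq_zero_left hprod,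
      Matrix.neg_mul]
  have h4 := congrFun (congrFun this i) j
  simp only [hN', Matrix.of_apply] at h4
  rw [h4, Matrix.neg_apply, Matrix.mul_apply]
  simp only [Matrix.mul_apply, Finset.sum_mul, hM', Matrix.of_apply]
  rw [Finset.sum_comm]

/-- If the coordinate functions are harmonic at `x` (which is the hypothesis `hT`), the
Laplacian at `x` is the metric trace of the matrix of second derivatives. -/
theorem coordLaplacian_eq_of_harmonic {g : (ι → ℝ) → Matrix ι ι ℝ} {h : (ι → ℝ) → ℝ} {x : ι → ℝ}
    (hg : ∀ i j, DifferentiableAt ℝ (fun y => g y i j) x) (hdet : 0 < (g x).det)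
    (hh : ∀ j, DifferentiableAt ℝ (fun y => fderiv ℝ h y (Pi.single j 1)) x)
    (hT : ∀ b, ∑ i, ∑ a, (g x)⁻¹ i a * fderiv ℝ (fun y => g y a b) x (Pi.single i 1) =
      1 / 2 * ∑ i, ∑ a, (g x)⁻¹ a i * fderiv ℝ (fun y => g y i a) x (Pi.single b 1)) :
    coordLaplacian g h x = -∑ i, ∑ j, (g x)⁻¹ i j *
      fderiv ℝ (fun y => fderiv ℝ h y (Pi.single j 1)) x (Pi.single i 1) := by
  have hs : √(g x).det ≠ 0 := (Real.sqrt_pos.2 hdet).ne'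
  have hdd := hasFDerivAt_matrix_det fun i j => (hg i j).hasFDerivAt
  have hsq := hdd.sqrt hdet.ne'
  have hN := differentiableAt_matrix_inv hg hdet.ne'
  have hadj : ∀ i j, (g x).adjugate i j = (g x).det * (g x)⁻¹ i j := by
    intro i j
    rw [Matrix.inv_def, Ring.inverse_eq_inv', Matrix.smul_apply, smul_eq_mul,
      mul_inv_cancel_left₀ hdet.ne']
  set tr : ι → ℝ := fun k =>
    ∑ i, ∑ a, (g x)⁻¹ a i * fderiv ℝ (fun y => g y i a) x (Pi.single k 1) with htr
  -- Jacobi's formula in the form `∂ₖ √|g| = √|g| · ½ tr(g⁻¹ ∂ₖ g)`.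
  have hsq' : ∀ k, fderiv ℝ (fun y => √(g y).det) x (Pi.single k 1) =
      √(g x).det * (1 / 2 * tr k) := by
    intro k
    rw [hsq.fderiv]
    simp only [_root_.sum_apply, _root_.smul_apply, smul_eq_mul, hadj,
      htr, mul_assoc, ← Finset.mul_sum]
    generalize ∑ i, ∑ a, (g x)⁻¹ a i * fderiv ℝ (fun y => g y i a) x (Pi.single k 1) = t
    field_simp
    rw [Real.sq_sqrt hdet.le]
  have hterm : ∀ i j, fderiv ℝ (fun y => √(g y).det * (g y)⁻¹ i j *
      fderiv ℝ h y (Pi.single j 1)) x (Pi.single i 1) =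
      √(g x).det * ((g x)⁻¹ i j *
          fderiv ℝ (fun y => fderiv ℝ h y (Pi.single j 1)) x (Pi.single i 1) +
        fderiv ℝ h x (Pi.single j 1) * (1 / 2 * tr i * (g x)⁻¹ i j -
          ∑ a, ∑ b, (g x)⁻¹ i a * fderiv ℝ (fun y => g y a b) x (Pi.single i 1) *
            (g x)⁻¹ b j)) := by
    intro i j
    have h1 := ((hsq.differentiableAt.hasFDerivAt.mul (hN i j).hasFDerivAt).mul
      (hh j).hasFDerivAt).fderiv
    have h2 := congrArg (fun φ : (ι → ℝ) →L[ℝ] ℝ => φ (Pi.single i 1)) h1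
    simp only [_root_.add_apply, _root_.smul_apply, smul_eq_mul, hsq',
      fderiv_matrix_inv hg hdet.ne'] at h2
    refine (Eq.trans ?_ h2).trans ?_
    · rfl
    · rw [Pi.mul_apply]
      ring
  -- Up to a factor this sum is the Laplacian of the coordinate function `xⱼ`; it is the coefficient
  -- of `∂ⱼ h`, and `hT` contracted with `g⁻¹` makes it vanish.
  have hzero : ∀ j, ∑ i, (1 / 2 * tr i * (g x)⁻¹ i j -
      ∑ a, ∑ b, (g x)⁻¹ i a * fderiv ℝ (fun y => g y a b) x (Pi.single i 1) *
        (g x)⁻¹ b j) = 0 := by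
    intro j
    rw [Finset.sum_sub_distrib, sub_eq_zero]
    have : ∀ b, 1 / 2 * tr b * (g x)⁻¹ b j =
        ∑ i, ∑ a, (g x)⁻¹ i a * fderiv ℝ (fun y => g y a b) x (Pi.single i 1) *
          (g x)⁻¹ b j := by
      intro b
      rw [htr, ← hT b]
      simp only [Finset.sum_mul]
    rw [Finset.sum_congr rfl fun b _ => this b, Finset.sum_comm]
    exact Finset.sum_congr rfl fun i _ => Finset.sum_comm
  rw [coordLaplacian]
  simp only [hterm, ← Finset.mul_sum]
  rw [← mul_assoc, neg_mul, one_div, inv_mul_cancel₀ hs, neg_one_mul]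
  congr 1
  simp only [Finset.sum_add_distrib]
  rw [add_eq_left, Finset.sum_comm]
  refine Finset.sum_eq_zero fun j _ => ?_
  rw [← Finset.mul_sum, hzero, mul_zero]

end CoordLaplacian

-- With the entrywise supremum norm `Mat2` is definitionally the normed space `Fin 2 → Fin 2 → ℂ`,
-- so `IsCnOnGL` can be read as a `ContDiffOn` statement on matrices.
attribute [local instance] Matrix.normedAddCommGroup Matrix.normedSpace

/-- The topology of the supremum norm on matrices. -/
abbrev Mat2.topology : TopologicalSpace Mat2 :=
  (Matrix.normedAddCommGroup (m := Fin 2) (n := Fin 2)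
    (α := ℂ)).toMetricSpace.toPseudoMetricSpace.toUniformSpace.toTopologicalSpace

attribute [local instance 2000] Mat2.topology

/-! ### Functions on `Rat₁` and their pull-backs -/

namespace Rat1

theorem pullback_of_det_ne_zero (f : Rat1 → ℝ) {L : Mat2} (h : L.det ≠ 0) :
    pullback f L = f (ofMatrix L h) := by
  rw [pullback, dif_pos h]

theorem mk_eq_of_smul {L M : GL (Fin 2) ℂ} {c : ℂ} (hc : c ≠ 0)
    (h : (M : Mat2) = c • (L : Mat2)) : mk M = mk L := by
  have hij : ∀ i j, M i j = c * L i j := fun i j => by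
    rw [show (M : Mat2) i j = (c • (L : Mat2)) i j by rw [h]]; rfl
  refine Subtype.ext (funext fun z => ?_)
  change M • z = L • z
  induction z using OnePoint.rec with
  | infty =>
    rw [OnePoint.smul_infty_eq_ite, OnePoint.smul_infty_eq_ite]
    simp only [hij, mul_eq_zero, hc, false_or, mul_div_mul_left _ _ hc]
  | coe z =>
    rw [OnePoint.smul_some_eq_ite, OnePoint.smul_some_eq_ite]
    simp only [hij, mul_assoc, ← mul_add, mul_eq_zero, hc, false_or, mul_div_mul_left _ _ hc]

/-- `N = L⁻¹ M` fixes every point of the sphere: fixing `∞` kills its lower left entry, fixing `0`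
the upper right one, and fixing `1` makes the diagonal entries equal, so `N` is scalar. -/
theorem exists_smul_of_mk_eq {L M : GL (Fin 2) ℂ} (h : mk M = mk L) :
    ∃ c : ℂ, c ≠ 0 ∧ (M : Mat2) = c • (L : Mat2) := by
  have h1 : ∀ z : OnePoint ℂ, M • z = L • z := fun z => congrFun (congrArg Subtype.val h) z
  have h2 : ∀ z : OnePoint ℂ, (L⁻¹ * M) • z = z := fun z => by
    rw [mul_smul, h1, inv_smul_smul]
  set N := L⁻¹ * M with hN
  have hMN : (M : Mat2) = (L : Mat2) * (N : Mat2) := by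
    rw [← Units.val_mul, hN, mul_inv_cancel_left]
  have h10 : N 1 0 = 0 := OnePoint.smul_infty_eq_self_iff.1 (h2 _)
  have hdet : N 0 0 * N 1 1 ≠ 0 := by
    have := N.det_ne_zero
    rw [Matrix.det_fin_two, h10] at this
    simpa using this
  have h11 : N 1 1 ≠ 0 := right_ne_zero_of_mul hdet
  have hz : ∀ z : ℂ, N 0 0 * z + N 0 1 = z * N 1 1 := fun z => by
    have h3 := h2 (z : OnePoint ℂ)
    rw [OnePoint.smul_some_eq_ite, h10, zero_mul, zero_add, if_neg h11, OnePoint.coe_eq_coe,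
      div_eq_iff h11] at h3
    exact h3
  have h01 : N 0 1 = 0 := by simpa using hz 0
  have h00 : N 0 0 = N 1 1 := by simpa [h01] using hz 1
  refine ⟨N 1 1, h11, ?_⟩
  have : (N : Mat2) = N 1 1 • (1 : Mat2) := by
    ext i j
    fin_cases i <;> fin_cases j <;> simp [h10, h01, h00]
  rw [hMN, this]
  simp

/-- `rep` is a choice, so it is controlled only up to a nonzero factor; the Laplacian must be shown
not to see this factor. -/
theorem exists_rep_ofMatrix {L : Mat2} (h : L.det ≠ 0) :
    ∃ c : ℂ, c ≠ 0 ∧ (ofMatrix L h).rep = c • L := by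
  have h1 : mk (ofMatrix L h).2.choose = mk (Matrix.GeneralLinearGroup.mkOfDetNeZero L h) :=
    Subtype.ext (funext fun z => ((ofMatrix L h).2.choose_spec z).symm)
  exact exists_smul_of_mk_eq h1

theorem det_smul_ne_zero {L : Mat2} {c : ℂ} (hc : c ≠ 0) : (c • L).det ≠ 0 ↔ L.det ≠ 0 := by
  simp [hc]

theorem pullback_smul (f : Rat1 → ℝ) (L : Mat2) {c : ℂ} (hc : c ≠ 0) :
    pullback f (c • L) = pullback f L := by
  by_cases h : L.det ≠ 0
  · rw [pullback_of_det_ne_zero f h, pullback_of_det_ne_zero f ((det_smul_ne_zero hc).2 h)]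
    congr 1
    exact mk_eq_of_smul hc rfl
  · have h' := mt (det_smul_ne_zero (L := L) hc).1 h
    rw [pullback, pullback, dif_neg h, dif_neg h']

end Rat1

theorem isOpen_det_ne_zero : IsOpen {L : Mat2 | L.det ≠ 0} :=
  isOpen_ne_fun (Continuous.matrix_det continuous_id) continuous_const

theorem IsCnOnGL.contDiffAt {n : ℕ∞} {u : Mat2 → ℝ} (hu : IsCnOnGL n u) {L : Mat2}
    (hL : L.det ≠ 0) : ContDiffAt ℝ n u L :=
  ContDiffOn.contDiffAt (s := {L : Mat2 | L.det ≠ 0}) hu (isOpen_det_ne_zero.mem_nhds hL)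

/-! ### The metric as a function with values in bilinear forms -/

theorem hasDerivAt_const_mul_matrix (A : Mat2) {X : ℝ → Mat2} {X' : Mat2} {t : ℝ}
    (h : HasDerivAt X X' t) : HasDerivAt (fun s => A * X s) (A * X') t :=
  (LinearMap.toContinuousLinearMap
    (LinearMap.mulLeft ℝ A)).hasFDerivAt.comp_hasDerivAt t h

theorem hasDerivAt_matrix_mul_const (A : Mat2) {X : ℝ → Mat2} {X' : Mat2} {t : ℝ}
    (h : HasDerivAt X X' t) : HasDerivAt (fun s => X s * A) (X' * A) t :=
  (LinearMap.toContinuousLinearMap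
    (LinearMap.mulRight ℝ A)).hasFDerivAt.comp_hasDerivAt t h

theorem hasDerivAt_I_smul_matrix {X : ℝ → Mat2} {X' : Mat2} {t : ℝ}
    (h : HasDerivAt X X' t) : HasDerivAt (fun s => Complex.I • X s) (Complex.I • X') t := by
  simpa using hasDerivAt_const_mul_matrix (Complex.I • (1 : Mat2)) h

theorem continuous_det_mat2 : Continuous fun L : Mat2 => L.det :=
  Continuous.matrix_det continuous_id

namespace RatMetric

/-- `γ.val L` as a continuous bilinear form. -/
def form (γ : RatMetric) (L : Mat2) : Mat2 →L[ℝ] Mat2 →L[ℝ] ℝ :=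
  LinearMap.toContinuousLinearMap
    ((LinearMap.toContinuousLinearMap (𝕜 := ℝ) (E := Mat2) (F' := ℝ)).toLinearMap ∘ₗ γ.val L)

theorem contDiffAt_form (γ : RatMetric) {L : Mat2} (hL : L.det ≠ 0) :
    ContDiffAt ℝ (⊤ : ℕ∞) γ.form L := by
  refine ContDiffOn.contDiffAt (s := {L : Mat2 | L.det ≠ 0})
    (contDiffOn_clm_apply.2 fun X => contDiffOn_clm_apply.2 fun Y => ?_)
    (isOpen_det_ne_zero.mem_nhds hL)
  exact γ.smooth X Y

theorem differentiableAt_form (γ : RatMetric) {L : Mat2} (hL : L.det ≠ 0) :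
    DifferentiableAt ℝ γ.form L :=
  (γ.contDiffAt_form hL).differentiableAt (by simp)

/-- The derivative at `L`, in the direction `Z`, of the inner product of two constant fields. -/
def dform (γ : RatMetric) (L Z : Mat2) : Mat2 →L[ℝ] Mat2 →L[ℝ] ℝ := fderiv ℝ γ.form L Z

theorem hasDerivAt_val (γ : RatMetric) {L X Y : ℝ → Mat2} {L' X' Y' : Mat2} {t : ℝ}
    (hdet : (L t).det ≠ 0) (hL : HasDerivAt L L' t) (hX : HasDerivAt X X' t)
    (hY : HasDerivAt Y Y' t) :
    HasDerivAt (fun s => γ.val (L s) (X s) (Y s))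
      (γ.dform (L t) L' (X t) (Y t) + γ.val (L t) X' (Y t) + γ.val (L t) (X t) Y') t := by
  have h : HasDerivAt (fun s => γ.form (L s)) (fderiv ℝ γ.form (L t) L') t :=
    HasFDerivAt.comp_hasDerivAt (l := γ.form) (l' := fderiv ℝ γ.form (L t)) t
      (γ.differentiableAt_form hdet).hasFDerivAt hL
  exact (h.clm_apply hX).clm_apply hY

theorem hasDerivAt_add_smul (L X : Mat2) : HasDerivAt (fun t : ℝ => L + t • X) X 0 := by
  simpa using ((hasDerivAt_id (0 : ℝ)).smul_const X).const_add L

theorem dirDerivForm_eq (γ : RatMetric) {L : Mat2} (hL : L.det ≠ 0) (X Y Z : Mat2) :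
    γ.dirDerivForm L X Y Z = γ.dform L X (Complex.I • Y) Z := by
  have h := γ.hasDerivAt_val (L := fun t : ℝ => L + t • X) (t := 0) (by simpa using hL)
    (hasDerivAt_add_smul L X) (hasDerivAt_const 0 (Complex.I • Y)) (hasDerivAt_const 0 Z)
  rw [dirDerivForm, h.deriv]
  simp

/-- An identity between two combinations of values of `γ` can be differentiated. -/
theorem dform_congr (γ : RatMetric) {L : Mat2} (hL : L.det ≠ 0) (Z : Mat2) {X Y X₁ Y₁ : Mat2}
    (h : ∀ M : Mat2, M.det ≠ 0 → γ.val M X Y = γ.val M X₁ Y₁) :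
    γ.dform L Z X Y = γ.dform L Z X₁ Y₁ := by
  have h1 := fun X Y : Mat2 => γ.hasDerivAt_val (L := fun t : ℝ => L + t • Z) (t := 0)
    (by simpa using hL) (hasDerivAt_add_smul L Z) (hasDerivAt_const 0 X) (hasDerivAt_const 0 Y)
  simp only [map_zero, LinearMap.zero_apply, add_zero, zero_smul] at h1
  refine (h1 X Y).unique ((h1 X₁ Y₁).congr_of_eventuallyEq ?_)
  have hc : Tendsto (fun t : ℝ => (L + t • Z).det) (𝓝 0) (𝓝 (L + (0 : ℝ) • Z).det) :=
    (continuous_det_mat2.tendsto _).comp (hasDerivAt_add_smul L Z).continuousAt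
  filter_upwards [hc.eventually_ne (by simpa using hL)] with t ht using h _ ht

theorem dform_symm (γ : RatMetric) {L : Mat2} (hL : L.det ≠ 0) (Z X Y : Mat2) :
    γ.dform L Z X Y = γ.dform L Z Y X :=
  γ.dform_congr hL Z fun M hM => γ.symm M hM X Y

variable {γ : RatMetric}

theorem IsKahler.dform_I_smul (hK : γ.IsKahler) {L : Mat2} (hL : L.det ≠ 0) (Z X Y : Mat2) :
    γ.dform L Z (Complex.I • X) (Complex.I • Y) = γ.dform L Z X Y :=
  γ.dform_congr hL Z fun M hM => hK.1 M hM X Y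

theorem IsKahler.closed (hK : γ.IsKahler) {L : Mat2} (hL : L.det ≠ 0) (X Y Z : Mat2) :
    γ.dform L X (Complex.I • Y) Z + γ.dform L Y (Complex.I • Z) X +
      γ.dform L Z (Complex.I • X) Y = 0 := by
  rw [← γ.dirDerivForm_eq hL, ← γ.dirDerivForm_eq hL, ← γ.dirDerivForm_eq hL]
  exact hK.2 L hL X Y Z

theorem I_smul_I_smul (X : Mat2) : Complex.I • Complex.I • X = -X := by
  rw [smul_smul, Complex.I_mul_I, neg_one_smul]

theorem IsKahler.val_I_left (hK : γ.IsKahler) {L : Mat2} (hL : L.det ≠ 0) (X Y : Mat2) :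
    γ.val L (Complex.I • X) Y = -γ.val L X (Complex.I • Y) := by
  rw [← hK.1 L hL (Complex.I • X) Y, I_smul_I_smul, map_neg, LinearMap.neg_apply]

theorem IsKahler.dform_I_left (hK : γ.IsKahler) {L : Mat2} (hL : L.det ≠ 0) (Z X Y : Mat2) :
    γ.dform L Z (Complex.I • X) Y = -γ.dform L Z X (Complex.I • Y) := by
  rw [← hK.dform_I_smul hL Z (Complex.I • X) Y, I_smul_I_smul, map_neg, _root_.neg_apply]

/-- The condition `dω = 0`, in terms of the metric. -/
theorem IsKahler.dform_eq (hK : γ.IsKahler) {L : Mat2} (hL : L.det ≠ 0) (X Y Z : Mat2) :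
    γ.dform L X Y Z = γ.dform L Z X Y - γ.dform L (Complex.I • Y) Z (Complex.I • X) := by
  have h := hK.closed hL X (Complex.I • Y) Z
  rw [I_smul_I_smul, map_neg, _root_.neg_apply, hK.dform_I_smul hL, hK.dform_I_left hL] at h
  linarith

/-! ### The Gram matrix -/

/-- Gram matrix of `γ` at `[L]` with respect to the tangent vectors `L τ_a`, `i L τ_a`. -/
def gram (γ : RatMetric) (L : Mat2) : Matrix (Fin 3 ⊕ Fin 3) (Fin 3 ⊕ Fin 3) ℝ :=
  Matrix.of fun i j => γ.val L (L * chartDir i) (L * chartDir j)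

theorem gram_apply (L : Mat2) (i j : Fin 3 ⊕ Fin 3) :
    γ.gram L i j = γ.val L (L * chartDir i) (L * chartDir j) := rfl

theorem gram_isSymm (γ : RatMetric) {L : Mat2} (hL : L.det ≠ 0) : (γ.gram L).IsSymm := by
  ext i j
  exact γ.symm L hL _ _

theorem mul_chartDir_inl (L : Mat2) (a : Fin 3) : L * chartDir (Sum.inl a) = L * pauli a := rfl

theorem mul_chartDir_inr (L : Mat2) (a : Fin 3) :
    L * chartDir (Sum.inr a) = Complex.I • (L * pauli a) := by
  simp [chartDir]

/-- The Pauli matrices are traceless and linearly independent over `ℂ`, so their span is transverse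
to the vertical line `ℂ 1`. This is what makes the Gram matrix of the frame positive definite. -/
theorem eq_zero_of_sum_chartDir_eq_smul_one {x : Fin 3 ⊕ Fin 3 → ℝ} {c : ℂ}
    (h : ∑ i, x i • chartDir i = c • (1 : Mat2)) : x = 0 := by
  have h00 := congrFun (congrFun h 0) 0
  have h01 := congrFun (congrFun h 0) 1
  have h10 := congrFun (congrFun h 1) 0
  have h11 := congrFun (congrFun h 1) 1
  simp [chartDir, pauli, Fin.sum_univ_three, Matrix.add_apply, Complex.ext_iff]
    at h00 h01 h10 h11
  ext i
  obtain i | i := i <;> fin_cases i <;> simp <;> linarith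

theorem gram_posDef (γ : RatMetric) {L : Mat2} (hL : L.det ≠ 0) : (γ.gram L).PosDef := by
  refine Matrix.PosDef.of_dotProduct_mulVec_pos (by
    rw [Matrix.IsHermitian, Matrix.conjTranspose_eq_transpose_of_trivial]
    exact γ.gram_isSymm hL) fun x hx => ?_
  have hval : star x ⬝ᵥ (γ.gram L *ᵥ x) =
      γ.val L (L * ∑ i, x i • chartDir i) (L * ∑ i, x i • chartDir i) := by
    simp only [Finset.mul_sum, map_sum, LinearMap.sum_apply, Matrix.mul_smul, map_smul,
      LinearMap.smul_apply, smul_eq_mul, dotProduct, Matrix.mulVec, star_trivial, gram_apply]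
    rw [Finset.sum_comm]
    refine Finset.sum_congr rfl fun i _ => Finset.sum_congr rfl fun j _ => ?_
    ring
  rw [hval]
  refine γ.pos L hL _ fun c hc => hx (eq_zero_of_sum_chartDir_eq_smul_one (c := c) ?_)
  have h1 : L⁻¹ * (L * ∑ i, x i • chartDir i) = L⁻¹ * (c • L) := by rw [hc]
  rwa [← Matrix.mul_assoc, Matrix.nonsing_inv_mul _ (Ne.isUnit hL), Matrix.one_mul,
    Matrix.mul_smul, Matrix.nonsing_inv_mul _ (Ne.isUnit hL)] at h1

/-- The complex structure in the frame `τ_a`, `i τ_a`. -/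
def frameJ : Matrix (Fin 3 ⊕ Fin 3) (Fin 3 ⊕ Fin 3) ℝ := Matrix.fromBlocks 0 1 (-1) 0

/-- Multiplication by `i` is an isometry with square `-1`, hence its matrix commutes with the Gram
matrix, and so with the inverse. -/
theorem IsKahler.inv_gram_mul_frameJ (hK : γ.IsKahler) {L : Mat2} (hL : L.det ≠ 0) :
    (γ.gram L)⁻¹ * frameJ = frameJ * (γ.gram L)⁻¹ := by
  have hu : IsUnit (γ.gram L).det := Ne.isUnit (γ.gram_posDef hL).det_pos.ne'
  have hG : frameJ * γ.gram L = γ.gram L * frameJ := by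
    ext i j
    obtain i | i := i <;> obtain j | j := j <;>
      simp [frameJ, Matrix.mul_apply, Fintype.sum_sum_type, Matrix.one_apply, gram_apply,
        mul_chartDir_inl, mul_chartDir_inr, hK.1 L hL, hK.val_I_left hL, I_smul_I_smul]
  calc (γ.gram L)⁻¹ * frameJ = (γ.gram L)⁻¹ * (frameJ * γ.gram L) * (γ.gram L)⁻¹ := by
        rw [Matrix.mul_assoc, Matrix.mul_assoc frameJ, Matrix.mul_nonsing_inv _ hu, Matrix.mul_one]
    _ = frameJ * (γ.gram L)⁻¹ := by
        rw [hG, ← Matrix.mul_assoc, Matrix.nonsing_inv_mul _ hu, Matrix.one_mul]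

/-- The inverse metric is Hermitian. -/
theorem IsKahler.sum_inv_gram_I_smul (hK : γ.IsKahler) {L : Mat2} (hL : L.det ≠ 0)
    (φ : Mat2 → Mat2 → ℝ) (hl : ∀ X Y, φ (-X) Y = -φ X Y) (hr : ∀ X Y, φ X (-Y) = -φ X Y) :
    ∑ i, ∑ j, (γ.gram L)⁻¹ i j *
        φ (Complex.I • (L * chartDir i)) (Complex.I • (L * chartDir j)) =
      ∑ i, ∑ j, (γ.gram L)⁻¹ i j * φ (L * chartDir i) (L * chartDir j) := by
  have hJ := hK.inv_gram_mul_frameJ hL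
  have h1 : ∀ a b, (γ.gram L)⁻¹ (Sum.inl a) (Sum.inl b) = (γ.gram L)⁻¹ (Sum.inr a) (Sum.inr b) := by
    intro a b
    have := congrFun (congrFun hJ (Sum.inl a)) (Sum.inr b)
    simpa [frameJ, Matrix.mul_apply, Fintype.sum_sum_type, Matrix.one_apply] using this
  have h2 : ∀ a b, (γ.gram L)⁻¹ (Sum.inl a) (Sum.inr b) =
      -(γ.gram L)⁻¹ (Sum.inr a) (Sum.inl b) := by
    intro a b
    have := congrFun (congrFun hJ (Sum.inl a)) (Sum.inl b)
    have h3 : -(γ.gram L)⁻¹ (Sum.inl a) (Sum.inr b) = (γ.gram L)⁻¹ (Sum.inr a) (Sum.inl b) := by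
      simpa [frameJ, Matrix.mul_apply, Fintype.sum_sum_type, Matrix.one_apply] using this
    linarith
  simp only [Fintype.sum_sum_type, mul_chartDir_inl, mul_chartDir_inr, I_smul_I_smul, hl, hr,
    Finset.sum_add_distrib, h1, h2, mul_neg, neg_mul, neg_neg]
  ring

/-- The complex coordinates of the affine chart are harmonic. -/
theorem IsKahler.sum_inv_gram_dform (hK : γ.IsKahler) {L : Mat2} (hL : L.det ≠ 0) (Z : Mat2) :
    ∑ i, ∑ j, (γ.gram L)⁻¹ i j * γ.dform L (L * chartDir i) (L * chartDir j) Z =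
      1 / 2 * ∑ i, ∑ j, (γ.gram L)⁻¹ j i * γ.dform L Z (L * chartDir i) (L * chartDir j) := by
  have hsymm : ∀ i j, (γ.gram L)⁻¹ i j = (γ.gram L)⁻¹ j i := fun i j =>
    congrFun (congrFun (Matrix.IsSymm.inv (γ.gram_isSymm hL)) j) i
  have h1 := hK.sum_inv_gram_I_smul hL (fun X Y => γ.dform L X Z Y)
    (fun X Y => by simp [dform]) (fun X Y => by simp)
  -- Let `T` be the left side. Closedness gives `T = tr - T'`, where `T'` has two slots multiplied
  -- by `i`; the Hermitian property (`h1`) and symmetry (`h3`) give `T' = T`, hence `2 T = tr`.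
  have h2 : ∑ i, ∑ j, (γ.gram L)⁻¹ i j * γ.dform L (L * chartDir i) (L * chartDir j) Z =
      ∑ i, ∑ j, (γ.gram L)⁻¹ j i * γ.dform L Z (L * chartDir i) (L * chartDir j) -
        ∑ i, ∑ j, (γ.gram L)⁻¹ i j * γ.dform L (Complex.I • (L * chartDir i)) Z
          (Complex.I • (L * chartDir j)) := by
    rw [Finset.sum_comm (f := fun i j => (γ.gram L)⁻¹ i j * γ.dform L
      (Complex.I • (L * chartDir i)) Z (Complex.I • (L * chartDir j)))]
    simp only [← Finset.sum_sub_distrib]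
    refine Finset.sum_congr rfl fun i _ => Finset.sum_congr rfl fun j _ => ?_
    rw [hK.dform_eq hL (L * chartDir i), hsymm i j, mul_sub]
  have h3 : ∑ i, ∑ j, (γ.gram L)⁻¹ i j * γ.dform L (L * chartDir i) Z (L * chartDir j) =
      ∑ i, ∑ j, (γ.gram L)⁻¹ i j * γ.dform L (L * chartDir i) (L * chartDir j) Z :=
    Finset.sum_congr rfl fun i _ => Finset.sum_congr rfl fun j _ => by
      rw [γ.dform_symm hL]
  rw [h1, h3] at h2
  linarith

end RatMetric

/-! ### The Laplacian as the trace of the second derivative -/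

/-- The linear part of the affine chart. -/
def chartLinear (L : Mat2) : (Fin 3 ⊕ Fin 3 → ℝ) →L[ℝ] Mat2 :=
  LinearMap.toContinuousLinearMap
    (LinearMap.mulLeft ℝ L ∘ₗ Fintype.linearCombination ℝ chartDir)

theorem affineChart_eq (L : Mat2) (x : Fin 3 ⊕ Fin 3 → ℝ) :
    affineChart L x = L + chartLinear L x := by
  rw [affineChart, mul_add, mul_one]
  rfl

theorem chartLinear_single (L : Mat2) (j : Fin 3 ⊕ Fin 3) :
    chartLinear L (Pi.single j 1) = L * chartDir j := by
  change L * Fintype.linearCombination ℝ chartDir (Pi.single j 1) = _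
  rw [Fintype.linearCombination_apply_single, one_smul]

theorem hasFDerivAt_affineChart (L : Mat2) (x : Fin 3 ⊕ Fin 3 → ℝ) :
    HasFDerivAt (affineChart L) (chartLinear L) x := by
  rw [show affineChart L = fun x => L + chartLinear L x from funext (affineChart_eq L)]
  exact (chartLinear L).hasFDerivAt.const_add L

theorem affineChart_zero (L : Mat2) : affineChart L 0 = L := by
  rw [affineChart_eq, map_zero, add_zero]

theorem affineChart_smul (c : ℂ) (L : Mat2) (x : Fin 3 ⊕ Fin 3 → ℝ) :
    affineChart (c • L) x = c • affineChart L x := Matrix.smul_mul _ _ _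

theorem fderiv_comp_affineChart {u : Mat2 → ℝ} {L : Mat2} {y : Fin 3 ⊕ Fin 3 → ℝ}
    (hu : DifferentiableAt ℝ u (affineChart L y)) (j : Fin 3 ⊕ Fin 3) :
    fderiv ℝ (fun x => u (affineChart L x)) y (Pi.single j 1) =
      fderiv ℝ u (affineChart L y) (L * chartDir j) := by
  rw [← chartLinear_single]
  have h : HasFDerivAt (fun x => u (affineChart L x))
      ((fderiv ℝ u (affineChart L y)).comp (chartLinear L)) y :=
    HasFDerivAt.comp (g := u) (g' := fderiv ℝ u (affineChart L y)) y hu.hasFDerivAt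
      (hasFDerivAt_affineChart L y)
  rw [h.fderiv]
  rfl

theorem eventually_det_affineChart {L : Mat2} (hL : L.det ≠ 0) :
    ∀ᶠ y in 𝓝 (0 : Fin 3 ⊕ Fin 3 → ℝ), (affineChart L y).det ≠ 0 := by
  have hc : ContinuousAt (affineChart L) 0 := (hasFDerivAt_affineChart L 0).continuousAt
  have hc' : Tendsto (fun y => (affineChart L y).det) (𝓝 0) (𝓝 (affineChart L 0).det) :=
    (continuous_det_mat2.tendsto _).comp hc
  exact hc'.eventually_ne (by rwa [affineChart_zero])

theorem IsCnOnGL.differentiableAt {u : Mat2 → ℝ} (hu : IsCnOnGL 2 u) {L : Mat2}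
    (hL : L.det ≠ 0) : DifferentiableAt ℝ u L :=
  (hu.contDiffAt hL).differentiableAt (by simp)

theorem IsCnOnGL.contDiffAt_fderiv {u : Mat2 → ℝ} (hu : IsCnOnGL 2 u) {L : Mat2}
    (hL : L.det ≠ 0) : ContDiffAt ℝ 1 (fderiv ℝ u) L :=
  (hu.contDiffAt hL).fderiv_right (m := 1) (by norm_cast)

theorem IsCnOnGL.differentiableAt_fderiv {u : Mat2 → ℝ} (hu : IsCnOnGL 2 u) {L : Mat2}
    (hL : L.det ≠ 0) : DifferentiableAt ℝ (fderiv ℝ u) L :=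
  (hu.contDiffAt_fderiv hL).differentiableAt (by simp)

theorem IsCnOnGL.continuousAt_fderiv_fderiv {u : Mat2 → ℝ} (hu : IsCnOnGL 2 u) {L : Mat2}
    (hL : L.det ≠ 0) : ContinuousAt (fderiv ℝ (fderiv ℝ u)) L :=
  ((hu.contDiffAt_fderiv hL).fderiv_right (m := 0) (by norm_cast)).continuousAt

theorem IsCnOnGL.fderiv_fderiv_symm {u : Mat2 → ℝ} (hu : IsCnOnGL 2 u) {L : Mat2}
    (hL : L.det ≠ 0) (X Y : Mat2) :
    fderiv ℝ (fderiv ℝ u) L X Y = fderiv ℝ (fderiv ℝ u) L Y X :=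
  (hu.contDiffAt hL).isSymmSndFDerivAt (by simp) X Y

/-- The chart is affine, so its own second derivative vanishes and only the Hessian of `u` on the
matrix space appears. -/
theorem IsCnOnGL.hasFDerivAt_fderiv_comp_affineChart {u : Mat2 → ℝ} (hu : IsCnOnGL 2 u) {L : Mat2}
    (hL : L.det ≠ 0) (j : Fin 3 ⊕ Fin 3) :
    HasFDerivAt (fun y => fderiv ℝ (fun x => u (affineChart L x)) y (Pi.single j 1))
      (((fderiv ℝ (fderiv ℝ u) L).flip (L * chartDir j)).comp (chartLinear L)) 0 := by
  have hev : (fun y => fderiv ℝ (fun x => u (affineChart L x)) y (Pi.single j 1)) =ᶠ[𝓝 0]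
      fun y => fderiv ℝ u (affineChart L y) (L * chartDir j) := by
    filter_upwards [eventually_det_affineChart hL] with y hy
    exact fderiv_comp_affineChart (hu.differentiableAt hy) j
  refine HasFDerivAt.congr_of_eventuallyEq ?_ hev
  have h0 : HasFDerivAt (fderiv ℝ u) (fderiv ℝ (fderiv ℝ u) L) (affineChart L 0) := by
    rw [affineChart_zero]
    exact (hu.differentiableAt_fderiv hL).hasFDerivAt
  have h1 : HasFDerivAt (fun y => fderiv ℝ u (affineChart L y))
      ((fderiv ℝ (fderiv ℝ u) L).comp (chartLinear L)) 0 :=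
    HasFDerivAt.comp (g := fderiv ℝ u) (g' := fderiv ℝ (fderiv ℝ u) L) 0 h0
      (hasFDerivAt_affineChart L 0)
  refine (h1.clm_apply (hasFDerivAt_const (L * chartDir j) 0)).congr_fderiv ?_
  ext v
  simp

namespace RatMetric

variable {γ : RatMetric}

/-- The trace of the second derivative of `u` with respect to the metric, with the sign of the
Laplacian. -/
def lapAt (γ : RatMetric) (u : Mat2 → ℝ) (L : Mat2) : ℝ :=
  -∑ i, ∑ j, (γ.gram L)⁻¹ i j *
    fderiv ℝ (fderiv ℝ u) L (L * chartDir i) (L * chartDir j)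

theorem hasFDerivAt_chartGram (γ : RatMetric) {L : Mat2} (hL : L.det ≠ 0)
    (i j : Fin 3 ⊕ Fin 3) :
    HasFDerivAt (fun y => γ.chartGram L y i j)
      ((((fderiv ℝ γ.form L).flip (L * chartDir i)).flip (L * chartDir j)).comp (chartLinear L))
      0 := by
  have h0 : HasFDerivAt γ.form (fderiv ℝ γ.form L) (affineChart L 0) := by
    rw [affineChart_zero]
    exact (γ.differentiableAt_form hL).hasFDerivAt
  have h1 : HasFDerivAt (fun y => γ.form (affineChart L y))
      ((fderiv ℝ γ.form L).comp (chartLinear L)) 0 :=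
    HasFDerivAt.comp (g := γ.form) (g' := fderiv ℝ γ.form L) 0 h0 (hasFDerivAt_affineChart L 0)
  have h2 := (h1.clm_apply (hasFDerivAt_const (L * chartDir i) 0)).clm_apply
    (hasFDerivAt_const (L * chartDir j) 0)
  refine HasFDerivAt.congr_fderiv (f := fun y => γ.chartGram L y i j) h2 ?_
  ext v
  simp

theorem chartGram_zero (L : Mat2) : γ.chartGram L 0 = γ.gram L := by
  ext i j
  rw [chartGram, affineChart_zero, Matrix.of_apply, gram_apply]

theorem IsKahler.coordLaplacian_chart (hK : γ.IsKahler) {u : Mat2 → ℝ} (hu : IsCnOnGL 2 u)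
    {L : Mat2} (hL : L.det ≠ 0) :
    coordLaplacian (γ.chartGram L) (fun x => u (affineChart L x)) 0 = γ.lapAt u L := by
  have hg := fun i j => γ.hasFDerivAt_chartGram hL i j
  have hg' : ∀ k i j, fderiv ℝ (fun y => γ.chartGram L y i j) 0 (Pi.single k 1) =
      γ.dform L (L * chartDir k) (L * chartDir i) (L * chartDir j) := by
    intro k i j
    rw [(hg i j).fderiv, ← chartLinear_single L k]
    rfl
  have hh := fun j => hu.hasFDerivAt_fderiv_comp_affineChart hL j
  rw [coordLaplacian_eq_of_harmonic (fun i j => (hg i j).differentiableAt)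
    (by rw [chartGram_zero]; exact (γ.gram_posDef hL).det_pos)
    (fun j => (hh j).differentiableAt) ?_, chartGram_zero, lapAt]
  · congr 1
    refine Finset.sum_congr rfl fun i _ => Finset.sum_congr rfl fun j _ => ?_
    rw [(hh j).fderiv, ← chartLinear_single L i]
    rfl
  · intro b
    simp only [hg', chartGram_zero]
    exact hK.sum_inv_gram_dform hL _

/-- The chosen representative is `c • L`; by `scale` and the homogeneity of the pull-back, the Gram
matrix near the centre and the function in the chart are the same for `L` and `c • L`. -/
theorem IsKahler.laplacian_ofMatrix (hK : γ.IsKahler) {f : Rat1 → ℝ} (hf : Rat1.IsCn 2 f)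
    {L : Mat2} (hL : L.det ≠ 0) :
    γ.laplacian f (Rat1.ofMatrix L hL) = γ.lapAt (Rat1.pullback f) L := by
  obtain ⟨c, hc, hrep⟩ := Rat1.exists_rep_ofMatrix hL
  have hcL : (c • L).det ≠ 0 := (Rat1.det_smul_ne_zero hc).2 hL
  rw [laplacian, hrep, ← hK.coordLaplacian_chart hf hL]
  have h1 : (fun x => Rat1.pullback f (affineChart (c • L) x)) =
      fun x => Rat1.pullback f (affineChart L x) := by
    funext x
    rw [affineChart_smul, Rat1.pullback_smul f _ hc]
  have h2 : γ.chartGram (c • L) =ᶠ[𝓝 0] γ.chartGram L := by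
    filter_upwards [eventually_det_affineChart hL] with y hy
    ext i j
    simp only [chartGram, Matrix.of_apply, affineChart_smul, Matrix.smul_mul,
      γ.scale _ hy c hc]
  rw [h1, coordLaplacian, coordLaplacian, h2.eq_of_nhds]
  congr 1
  refine Finset.sum_congr rfl fun i _ => Finset.sum_congr rfl fun j _ => ?_
  rw [Filter.EventuallyEq.fderiv_eq]
  filter_upwards [h2] with y hy
  rw [hy]

end RatMetric

/-! ### Pauli matrices -/

/-- `x · τ` -/
def tau (x : Fin 3 → ℝ) : Mat2 := ∑ a, x a • pauli a

theorem tau_eq (x : Fin 3 → ℝ) :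
    tau x = !![(x 2 : ℂ), x 0 - x 1 * Complex.I; x 0 + x 1 * Complex.I, -(x 2 : ℂ)] := by
  ext i j
  fin_cases i <;> fin_cases j <;> simp [tau, pauli, Fin.sum_univ_three, Matrix.add_apply]
  ring

theorem boost_eq_tau (l : Fin 3 → ℝ) : boost l = capLam (len l) • (1 : Mat2) + tau l := rfl

theorem tau_smul (c : ℝ) (x : Fin 3 → ℝ) : tau (c • x) = c • tau x := by
  simp [tau, Finset.smul_sum, smul_smul]

theorem tau_single (a : Fin 3) : tau (Pi.single a 1) = pauli a := by
  simp [tau, Pi.single_apply, Finset.sum_ite_eq']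

/-- The infinitesimal rotation `(i/2) τ_a`. -/
def gen (a : Fin 3) : Mat2 := (Complex.I / 2) • pauli a

/-- Together with the two cyclic relations: every generator is, up to sign, a commutator, so a
linear condition on commutators holds on all of `su(2)`. -/
theorem gen_comm_01 : gen 0 * gen 1 - gen 1 * gen 0 = -gen 2 := by
  ext i j
  fin_cases i <;> fin_cases j <;> simp [gen, pauli, Complex.ext_iff] <;> norm_num

theorem gen_comm_12 : gen 1 * gen 2 - gen 2 * gen 1 = -gen 0 := by
  ext i j
  fin_cases i <;> fin_cases j <;> simp [gen, pauli, Complex.ext_iff] <;> norm_num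

theorem gen_comm_20 : gen 2 * gen 0 - gen 0 * gen 2 = -gen 1 := by
  ext i j
  fin_cases i <;> fin_cases j <;> simp [gen, pauli, Complex.ext_iff] <;> norm_num

theorem oneParam_val (a : Fin 3) (t : ℝ) :
    (oneParam a t).1 =
      Real.cos (t / 2) • (1 : Mat2) + ((Real.sin (t / 2) : ℂ) * Complex.I) • pauli a := rfl

theorem oneParam_zero (a : Fin 3) : (oneParam a 0).1 = 1 := by
  simp [oneParam_val]

theorem hasDerivAt_oneParam (a : Fin 3) : HasDerivAt (fun t => (oneParam a t).1) (gen a) 0 := by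
  have h0 : HasDerivAt (fun t : ℝ => t / 2) (1 / 2) 0 := (hasDerivAt_id (0 : ℝ)).div_const 2
  have hc : HasDerivAt (fun t : ℝ => Real.cos (t / 2)) 0 0 := by simpa using h0.cos
  have hs : HasDerivAt (fun t : ℝ => Real.sin (t / 2)) (1 / 2) 0 := by simpa using h0.sin
  have h1 := (hc.smul_const (1 : Mat2)).add (hs.smul_const (Complex.I • pauli a))
  have h2 : (0 : ℝ) • (1 : Mat2) + (1 / 2 : ℝ) • Complex.I • pauli a = gen a := by
    rw [zero_smul, zero_add, gen, ← smul_assoc]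
    congr 1
    simp [Complex.ext_iff]
  rw [h2] at h1
  refine h1.congr_of_eventuallyEq (Filter.Eventually.of_forall fun t => ?_)
  change (oneParam a t).1 = _
  rw [oneParam_val, Pi.add_apply, mul_smul]
  rfl

theorem det_SU2_mul (U : SU2) (L : Mat2) : (U.1 * L).det = L.det := by
  rw [Matrix.det_mul, (Matrix.mem_specialUnitaryGroup_iff.1 U.2).2, one_mul]

theorem det_mul_SU2 (U : SU2) (L : Mat2) : (L * U.1).det = L.det := by
  rw [Matrix.det_mul, (Matrix.mem_specialUnitaryGroup_iff.1 U.2).2, mul_one]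

theorem SU2_mul_inv (U : SU2) : U.1 * (U⁻¹).1 = 1 := congrArg Subtype.val (mul_inv_cancel U)

namespace RatMetric

variable {γ : RatMetric}

/-! ### Consequences of invariance -/

theorem IsInvariant.val_left (hG : γ.IsInvariant) (U : SU2) {L : Mat2} (hL : L.det ≠ 0)
    (X Y : Mat2) : γ.val (U.1 * L) (U.1 * X) (U.1 * Y) = γ.val L X Y := by
  simpa using hG U 1 L hL X Y

theorem IsInvariant.val_right (hG : γ.IsInvariant) (U : SU2) {L : Mat2} (hL : L.det ≠ 0)
    (X Y : Mat2) : γ.val (L * U.1) (X * U.1) (Y * U.1) = γ.val L X Y := by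
  simpa using hG 1 U⁻¹ L hL X Y

/-- Conjugation invariance, with `L₁ = V L V⁻¹` phrased as an intertwining relation, the form in
which rotations of the Pauli matrices are given. -/
theorem IsInvariant.val_conj (hG : γ.IsInvariant) (V : SU2) {L L₁ X X₁ Y Y₁ : Mat2}
    (hdet : L.det ≠ 0) (hL : V.1 * L = L₁ * V.1) (hX : V.1 * X = X₁ * V.1)
    (hY : V.1 * Y = Y₁ * V.1) : γ.val L₁ X₁ Y₁ = γ.val L X Y := by
  have h := hG V V L hdet X Y
  simpa only [hL, hX, hY, Matrix.mul_assoc, SU2_mul_inv, Matrix.mul_one] using h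

/-- The Killing equation: along a one-parameter subgroup the inner product of two transported
vectors is constant. -/
theorem IsInvariant.dform_left (hG : γ.IsInvariant) {L : Mat2} (hL : L.det ≠ 0) (a : Fin 3)
    (X Y : Mat2) :
    γ.dform L (gen a * L) X Y = -γ.val L (gen a * X) Y - γ.val L X (gen a * Y) := by
  have hg := hasDerivAt_oneParam a
  have h := γ.hasDerivAt_val (L := fun t => (oneParam a t).1 * L) (t := 0)
    (by rwa [det_SU2_mul]) (hasDerivAt_matrix_mul_const L hg) (hasDerivAt_matrix_mul_const X hg)
    (hasDerivAt_matrix_mul_const Y hg)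
  simp only [hG.val_left _ hL, oneParam_zero, Matrix.one_mul] at h
  have h0 := h.unique (hasDerivAt_const 0 _)
  linarith

theorem IsInvariant.dform_right (hG : γ.IsInvariant) {L : Mat2} (hL : L.det ≠ 0) (a : Fin 3)
    (X Y : Mat2) :
    γ.dform L (L * gen a) X Y = -γ.val L (X * gen a) Y - γ.val L X (Y * gen a) := by
  have hg := hasDerivAt_oneParam a
  have h := γ.hasDerivAt_val (L := fun t => L * (oneParam a t).1) (t := 0)
    (by rwa [det_mul_SU2]) (hasDerivAt_const_mul_matrix L hg) (hasDerivAt_const_mul_matrix X hg)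
    (hasDerivAt_const_mul_matrix Y hg)
  simp only [hG.val_right _ hL, oneParam_zero, Matrix.mul_one] at h
  have h0 := h.unique (hasDerivAt_const 0 _)
  linarith

theorem IsKahler.val_I_swap (hK : γ.IsKahler) {L : Mat2} (hL : L.det ≠ 0) (X Y : Mat2) :
    γ.val L (Complex.I • X) Y = -γ.val L (Complex.I • Y) X := by
  rw [hK.val_I_left hL, γ.symm L hL]

/-- The fundamental form vanishes on a commutator of two generators of the left action and a
generator of the right action. -/
theorem IsKahler.val_comm_right (hK : γ.IsKahler) (hG : γ.IsInvariant) {L : Mat2} (hL : L.det ≠ 0)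
    (a b c : Fin 3) :
    γ.val L (Complex.I • ((gen a * gen b - gen b * gen a) * L)) (L * gen c) = 0 := by
  have h := hK.closed hL (gen a * L) (gen b * L) (L * gen c)
  rw [hG.dform_left hL, hG.dform_left hL, hG.dform_right hL] at h
  simp only [Matrix.mul_smul, Matrix.smul_mul] at h
  -- Left and right multiplication commute, so by antisymmetry of `ω` the terms mixing `gen a` or
  -- `gen b` with `gen c` cancel in pairs; only the commutator of `gen a` and `gen b` survives.
  have e1 := hK.val_I_swap hL (gen b * L) (gen a * (L * gen c))
  have e2 := hK.val_I_swap hL (gen b * (L * gen c)) (gen a * L)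
  have e3 := hK.val_I_swap hL (L * gen c) (gen b * (gen a * L))
  rw [sub_mul, smul_sub, map_sub, LinearMap.sub_apply]
  simp only [Matrix.mul_assoc] at h ⊢
  linarith

/-- The orbits of the left and of the right action are orthogonal for the fundamental form. -/
theorem IsKahler.val_gen_right (hK : γ.IsKahler) (hG : γ.IsInvariant) {L : Mat2} (hL : L.det ≠ 0)
    (a c : Fin 3) : γ.val L (Complex.I • (gen a * L)) (L * gen c) = 0 := by
  have h01 := hK.val_comm_right hG hL 0 1 c
  have h12 := hK.val_comm_right hG hL 1 2 c
  have h20 := hK.val_comm_right hG hL 2 0 c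
  rw [gen_comm_01] at h01
  rw [gen_comm_12] at h12
  rw [gen_comm_20] at h20
  simp only [neg_mul, smul_neg, map_neg, LinearMap.neg_apply, neg_eq_zero] at h01 h12 h20
  fin_cases a
  exacts [h12, h20, h01]

theorem IsKahler.val_pauli_right (hK : γ.IsKahler) (hG : γ.IsInvariant) {L : Mat2} (hL : L.det ≠ 0)
    (a c : Fin 3) : γ.val L (pauli a * L) (Complex.I • (L * pauli c)) = 0 := by
  have h := hK.val_gen_right hG hL a c
  have e1 : Complex.I • (gen a * L) = (-1 / 2 : ℝ) • (pauli a * L) := by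
    rw [gen, Matrix.smul_mul, smul_smul, ← smul_one_smul ℂ (-1 / 2 : ℝ)]
    congr 1
    apply Complex.ext <;> norm_num [Complex.div_re, Complex.div_im]
  have e2 : L * gen c = (1 / 2 : ℝ) • (Complex.I • (L * pauli c)) := by
    rw [gen, Matrix.mul_smul, ← smul_assoc]
    congr 1
    apply Complex.ext <;> norm_num [Complex.div_re, Complex.div_im]
  rw [e1, e2] at h
  simpa using h

/-- The fundamental form on two generators of the left action is a moment map for their
commutator. -/
theorem IsKahler.hasDerivAt_val_gen (hK : γ.IsKahler) (hG : γ.IsInvariant) {L : ℝ → Mat2}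
    {L' : Mat2} {t : ℝ} (hdet : (L t).det ≠ 0) (hL : HasDerivAt L L' t) (a b : Fin 3) :
    HasDerivAt (fun s => γ.val (L s) (Complex.I • (gen a * L s)) (gen b * L s))
      (γ.val (L t) (Complex.I • ((gen a * gen b - gen b * gen a) * L t)) L') t := by
  have h := γ.hasDerivAt_val hdet hL
    (hasDerivAt_I_smul_matrix (hasDerivAt_const_mul_matrix (gen a) hL))
    (hasDerivAt_const_mul_matrix (gen b) hL)
  refine h.congr_deriv ?_
  have hc := hK.closed hdet (gen a * L t) (gen b * L t) L'
  rw [hG.dform_left hdet, hG.dform_left hdet] at hc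
  simp only [Matrix.mul_smul] at hc
  have e1 := hK.val_I_swap hdet (gen b * L t) (gen a * L')
  have e2 := hK.val_I_swap hdet (gen b * L') (gen a * L t)
  have e3 := hK.val_I_swap hdet L' (gen b * (gen a * L t))
  rw [sub_mul, smul_sub, map_sub, LinearMap.sub_apply]
  simp only [Matrix.mul_assoc] at hc ⊢
  linarith

end RatMetric

/-! ### The curve `boost` -/

theorem capLam_pos (s : ℝ) : 0 < capLam s := Real.sqrt_pos.2 (by positivity)

theorem capLam_sq (s : ℝ) : capLam s ^ 2 = 1 + s ^ 2 := Real.sq_sqrt (by positivity)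

theorem dotProduct_self_nonneg_real (l : Fin 3 → ℝ) : 0 ≤ l ⬝ᵥ l :=
  Finset.sum_nonneg fun _ _ => mul_self_nonneg _

theorem len_sq (l : Fin 3 → ℝ) : len l ^ 2 = l ⬝ᵥ l :=
  Real.sq_sqrt (dotProduct_self_nonneg_real l)

theorem len_pos {l : Fin 3 → ℝ} (hl : l ≠ 0) : 0 < len l :=
  Real.sqrt_pos.2 ((dotProduct_self_nonneg_real l).lt_of_ne'
    (mt dotProduct_self_eq_zero.1 hl))

theorem capLam_len (l : Fin 3 → ℝ) : capLam (len l) = √(1 + l ⬝ᵥ l) := by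
  rw [capLam, len_sq]

theorem hasDerivAt_capLam (s : ℝ) : HasDerivAt capLam (s / capLam s) s := by
  have h := (((hasDerivAt_id s).pow 2).const_add 1).sqrt (f := fun x : ℝ => 1 + id x ^ 2)
    (by simp only [id]; positivity)
  refine h.congr_deriv ?_
  simp only [id, capLam]
  field_simp
  simp

theorem hasDerivAt_tau {l : ℝ → Fin 3 → ℝ} {l' : Fin 3 → ℝ} {t : ℝ} (h : HasDerivAt l l' t) :
    HasDerivAt (fun s => tau (l s)) (tau l') t :=
  HasDerivAt.fun_sum fun a _ => (hasDerivAt_pi.1 h a).smul_const (pauli a)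

theorem hasDerivAt_boost {l : ℝ → Fin 3 → ℝ} {l' : Fin 3 → ℝ} {t : ℝ} (h : HasDerivAt l l' t) :
    HasDerivAt (fun s => boost (l s))
      ((l t ⬝ᵥ l' / capLam (len (l t))) • (1 : Mat2) + tau l') t := by
  have h1 : HasDerivAt (fun s => l s ⬝ᵥ l s) (2 * (l t ⬝ᵥ l')) t := by
    have := HasDerivAt.fun_sum (u := Finset.univ) (A := fun a s => l s a * l s a) (x := t)
      fun a _ => (hasDerivAt_pi.1 h a).mul (hasDerivAt_pi.1 h a)
    refine this.congr_deriv ?_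
    rw [dotProduct, Finset.mul_sum]
    exact Finset.sum_congr rfl fun a _ => by ring
  have hpos : 0 < 1 + l t ⬝ᵥ l t := by
    have := dotProduct_self_nonneg_real (l t)
    linarith
  have h2 : HasDerivAt (fun s => capLam (len (l s))) (l t ⬝ᵥ l' / capLam (len (l t))) t := by
    simp only [capLam_len]
    refine ((h1.const_add 1).sqrt hpos.ne').congr_deriv ?_
    field_simp
  exact (h2.smul_const (1 : Mat2)).add (hasDerivAt_tau h)

/-- The point `(0, 0, s)` of the third axis. -/
abbrev axis (s : ℝ) : Fin 3 → ℝ := ![0, 0, s]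

theorem capLam_len_axis (s : ℝ) : capLam (len (axis s)) = capLam s := by
  rw [capLam_len, capLam]
  simp [dotProduct, Fin.sum_univ_three, sq]

theorem boost_axis (s : ℝ) : boost (axis s) = capLam s • (1 : Mat2) + s • pauli 2 := by
  rw [boost_eq_tau, capLam_len_axis, tau]
  simp [Fin.sum_univ_three]

theorem det_boost_ne_zero (l : Fin 3 → ℝ) : (boost l).det ≠ 0 := by
  rw [det_boost]
  exact one_ne_zero

/-- The first coordinate direction is orthogonal to the third axis, so `Λ` is stationary at `t = 0`.
-/
theorem velocity_eq (s : ℝ) : velocity s = pauli 0 := by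
  have hl : HasDerivAt (fun t : ℝ => (![t, 0, s] : Fin 3 → ℝ)) ![1, 0, 0] 0 := by
    rw [hasDerivAt_pi]
    intro i
    fin_cases i
    exacts [hasDerivAt_id _, hasDerivAt_const _ _, hasDerivAt_const _ _]
  have h := hasDerivAt_boost hl
  have h0 : tau ![1, 0, 0] = pauli 0 := by simp [tau, Fin.sum_univ_three]
  simp only [h0] at h
  ext i j
  have hij : HasDerivAt (fun t : ℝ => boost ![t, 0, s] i j) _ 0 :=
    hasDerivAt_pi.1 (hasDerivAt_pi.1 h i) j
  rw [velocity, Matrix.of_apply, hij.deriv]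
  simp [dotProduct, Fin.sum_univ_three]

theorem capLam_sq_complex (s : ℝ) : (capLam s : ℂ) ^ 2 = 1 + (s : ℂ) ^ 2 := by
  exact_mod_cast congrArg (fun x : ℝ => (x : ℂ)) (capLam_sq s)

/-- With `P = Λ + s τ₃` one has `P⁻¹ = Λ - s τ₃` and `τ₃ τ₁ = i τ₂`. -/
theorem pauli_zero_eq (s : ℝ) : pauli 0 =
    capLam s • (boost (axis s) * pauli 0) - s • Complex.I • (boost (axis s) * pauli 1) := by
  have h := capLam_sq_complex s
  rw [boost_axis]
  ext i j
  fin_cases i <;> fin_cases j <;> simp [pauli, Matrix.add_apply, Matrix.mul_apply,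
    Fin.sum_univ_two, mul_left_comm _ Complex.I] <;> grind [Complex.I_mul_I]

/-- Since `τ₁` anticommutes with `τ₃`, `P⁻¹ τ₁ P = τ₁ P²`. This writes a left generator in the frame
`P τ_a`, `i P τ_a` of right generators. -/
theorem pauli_zero_mul_boost (s : ℝ) : pauli 0 * boost (axis s) =
    (capLam s ^ 2 + s ^ 2) • (boost (axis s) * pauli 0) -
      (2 * capLam s * s) • Complex.I • (boost (axis s) * pauli 1) := by
  have h := capLam_sq_complex s
  rw [boost_axis]
  ext i j
  fin_cases i <;> fin_cases j <;> simp [pauli, Matrix.add_apply, Matrix.mul_apply,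
    Fin.sum_univ_two] <;> grind [Complex.I_mul_I]

theorem pauli_one_mul_boost (s : ℝ) : pauli 1 * boost (axis s) =
    (capLam s ^ 2 + s ^ 2) • (boost (axis s) * pauli 1) +
      (2 * capLam s * s) • Complex.I • (boost (axis s) * pauli 0) := by
  have h := capLam_sq_complex s
  rw [boost_axis]
  ext i j
  fin_cases i <;> fin_cases j <;> simp [pauli, Matrix.add_apply, Matrix.mul_apply,
    Fin.sum_univ_two] <;> grind [Complex.I_mul_I]

theorem pauli_two_mul_boost (s : ℝ) : pauli 2 * boost (axis s) = boost (axis s) * pauli 2 := by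
  rw [boost_axis]
  simp [add_mul, mul_add]

theorem hasDerivAt_boost_axis (s : ℝ) :
    HasDerivAt (fun t => boost (axis t)) ((capLam s)⁻¹ • (boost (axis s) * pauli 2)) s := by
  have hl : HasDerivAt axis ![0, 0, 1] s := by
    rw [hasDerivAt_pi]
    intro i
    fin_cases i
    exacts [hasDerivAt_const _ _, hasDerivAt_const _ _, hasDerivAt_id _]
  refine (hasDerivAt_boost hl).congr_deriv ?_
  have h2 : pauli 2 * pauli 2 = 1 := by
    ext i j
    fin_cases i <;> fin_cases j <;> simp [pauli]
  have h0 : tau ![0, 0, 1] = pauli 2 := by simp [tau, Fin.sum_univ_three]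
  rw [boost_axis, capLam_len_axis, h0, add_mul, Matrix.smul_mul, Matrix.smul_mul, Matrix.one_mul,
    h2, smul_add, smul_smul, inv_mul_cancel₀ (capLam_pos s).ne', one_smul, smul_smul, add_comm]
  congr 2
  simp [dotProduct, Fin.sum_univ_three]
  ring

namespace RatMetric

variable {γ : RatMetric}

/-! ### The metric at the points of the third axis -/

theorem IsKahler.val_I_self (hK : γ.IsKahler) {L : Mat2} (hL : L.det ≠ 0) (X : Mat2) :
    γ.val L X (Complex.I • X) = 0 := by
  have h1 := hK.val_I_left hL X X
  rw [γ.symm L hL] at h1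
  linarith

theorem IsKahler.val_I_right (hK : γ.IsKahler) {L : Mat2} (hL : L.det ≠ 0) (X Y : Mat2) :
    γ.val L X (Complex.I • Y) = -γ.val L Y (Complex.I • X) := by
  rw [γ.symm L hL, hK.val_I_left hL]

/-- Orthogonality of `τ₁ P`, `τ₂ P` to the right orbit gives two linear relations: the two
transverse lengths are equal, and `(Λ² + s²) k = 2 Λ s h`. The expansion of `A` in the frame then
fixes both `h` and `k`. The equality of lengths needs division by `s`. -/
theorem IsKahler.val_axis (hK : γ.IsKahler) (hG : γ.IsInvariant) {s : ℝ} (hs : s ≠ 0) :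
    γ.val (boost (axis s)) (boost (axis s) * pauli 0) (boost (axis s) * pauli 0) =
      (capLam s ^ 2 + s ^ 2) * γ.A s ∧
    γ.val (boost (axis s)) (boost (axis s) * pauli 1) (boost (axis s) * pauli 1) =
      (capLam s ^ 2 + s ^ 2) * γ.A s ∧
    γ.val (boost (axis s)) (boost (axis s) * pauli 0) (Complex.I • (boost (axis s) * pauli 1)) =
      2 * capLam s * s * γ.A s := by
  have hd := det_boost_ne_zero (axis s)
  have e01 := hK.val_pauli_right hG hd 0 1
  have e10 := hK.val_pauli_right hG hd 1 0
  have hA : γ.A s = γ.val (boost (axis s)) (pauli 0) (pauli 0) := by rw [A, velocity_eq]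
  rw [pauli_zero_mul_boost] at e01
  rw [pauli_one_mul_boost] at e10
  rw [pauli_zero_eq s] at hA
  have sw := hK.val_I_right hd (boost (axis s) * pauli 1) (boost (axis s) * pauli 0)
  have sw' := hK.val_I_left hd (boost (axis s) * pauli 1) (boost (axis s) * pauli 0)
  simp only [map_sub, map_add, map_smul, LinearMap.sub_apply, LinearMap.add_apply,
    LinearMap.smul_apply, smul_eq_mul, hK.1 _ hd, sw, sw'] at e01 e10 hA
  set h11 := γ.val (boost (axis s)) (boost (axis s) * pauli 0) (boost (axis s) * pauli 0)
  set h22 := γ.val (boost (axis s)) (boost (axis s) * pauli 1) (boost (axis s) * pauli 1)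
  set k := γ.val (boost (axis s)) (boost (axis s) * pauli 0)
    (Complex.I • (boost (axis s) * pauli 1))
  have hL := capLam_sq s
  have hp := capLam_pos s
  set Λ := capLam s
  have h12 : h11 = h22 := by
    have : 2 * Λ * s ≠ 0 := by positivity
    refine mul_left_cancel₀ this ?_
    linarith
  have hc : Λ ^ 2 + s ^ 2 ≠ 0 := by positivity
  have hk : (Λ ^ 2 + s ^ 2) * k = 2 * Λ * s * h11 := by linarith
  rw [← h12] at hA
  -- The cancellation rests on `(Λ² + s²)² - (2 Λ s)² = (Λ² - s²)² = 1`.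
  have h1 : h11 = (Λ ^ 2 + s ^ 2) * γ.A s := by
    rw [hA]
    linear_combination 2 * Λ * s * hk - h11 * (Λ ^ 2 - s ^ 2 + 1) * hL
  refine ⟨h1, h12 ▸ h1, mul_left_cancel₀ hc ?_⟩
  rw [hk, h1]
  ring

/-- As `τ₃` commutes with `P`, orthogonality to the right orbit applies directly to `P τ₃`; the
other relations then leave single terms with the nonzero factor `2 Λ s`. -/
theorem IsKahler.val_axis_offdiag (hK : γ.IsKahler) (hG : γ.IsInvariant) {s : ℝ} (hs : s ≠ 0) :
    γ.val (boost (axis s)) (boost (axis s) * pauli 0) (boost (axis s) * pauli 1) = 0 ∧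
    γ.val (boost (axis s)) (boost (axis s) * pauli 0) (boost (axis s) * pauli 2) = 0 ∧
    γ.val (boost (axis s)) (boost (axis s) * pauli 1) (boost (axis s) * pauli 2) = 0 ∧
    (∀ a, γ.val (boost (axis s)) (boost (axis s) * pauli 2)
      (Complex.I • (boost (axis s) * pauli a)) = 0) := by
  have hd := det_boost_ne_zero (axis s)
  have e20 := hK.val_pauli_right hG hd 2 0
  have e21 := hK.val_pauli_right hG hd 2 1
  have e2 := fun a => hK.val_pauli_right hG hd 2 a
  have e00 := hK.val_pauli_right hG hd 0 0
  have e02 := hK.val_pauli_right hG hd 0 2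
  have e12 := hK.val_pauli_right hG hd 1 2
  rw [pauli_zero_mul_boost] at e00 e02
  rw [pauli_one_mul_boost] at e12
  simp only [pauli_two_mul_boost] at e20 e21 e2
  have s20 := hK.val_I_right hd (boost (axis s) * pauli 0) (boost (axis s) * pauli 2)
  have s21 := hK.val_I_right hd (boost (axis s) * pauli 1) (boost (axis s) * pauli 2)
  have s01 := γ.symm _ hd (boost (axis s) * pauli 1) (boost (axis s) * pauli 0)
  simp only [map_sub, map_add, map_smul, LinearMap.sub_apply, LinearMap.add_apply,
    LinearMap.smul_apply, smul_eq_mul, hK.1 _ hd, s20, s21, e20, e21, s01,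
    hK.val_I_self hd] at e00 e02 e12
  have hp := capLam_pos s
  have hne : 2 * capLam s * s ≠ 0 := by positivity
  simp only [neg_zero, mul_zero, zero_sub, zero_add, neg_eq_zero, mul_eq_zero, hne, false_or]
    at e00 e02 e12
  exact ⟨e00, e12, e02, e2⟩

theorem differentiableAt_A (γ : RatMetric) (s : ℝ) : DifferentiableAt ℝ γ.A s := by
  have h := γ.hasDerivAt_val (L := fun t => boost (axis t)) (det_boost_ne_zero (axis s))
    (hasDerivAt_boost_axis s)
    (hasDerivAt_const s (pauli 0)) (hasDerivAt_const s (pauli 0))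
  refine h.differentiableAt.congr_of_eventuallyEq (Filter.Eventually.of_forall fun t => ?_)
  rw [A, velocity_eq]

theorem IsKahler.val_axis_gen (hK : γ.IsKahler) (hG : γ.IsInvariant) {s : ℝ} (hs : s ≠ 0) :
    γ.val (boost (axis s)) (Complex.I • (gen 0 * boost (axis s))) (gen 1 * boost (axis s)) =
      1 / 2 * (capLam s * s * γ.A s) := by
  have hd := det_boost_ne_zero (axis s)
  obtain ⟨h11, h22, h12⟩ := hK.val_axis hG hs
  have e1 : Complex.I • (gen 0 * boost (axis s)) = (-1 / 2 : ℝ) • (pauli 0 * boost (axis s)) := by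
    rw [gen, Matrix.smul_mul, smul_smul, ← smul_one_smul ℂ (-1 / 2 : ℝ)]
    congr 1
    apply Complex.ext <;> norm_num [Complex.div_re, Complex.div_im]
  have e2 : gen 1 * boost (axis s) = (1 / 2 : ℝ) • (Complex.I • (pauli 1 * boost (axis s))) := by
    rw [gen, Matrix.smul_mul, ← smul_assoc]
    congr 1
    apply Complex.ext <;> norm_num [Complex.div_re, Complex.div_im]
  have sw := hK.val_I_left hd (boost (axis s) * pauli 1) (boost (axis s) * pauli 0)
  have sw' := hK.val_I_right hd (boost (axis s) * pauli 1) (boost (axis s) * pauli 0)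
  rw [e1, e2, pauli_zero_mul_boost, pauli_one_mul_boost, smul_add, smul_comm Complex.I
    (2 * capLam s * s), I_smul_I_smul, smul_comm Complex.I (capLam s ^ 2 + s ^ 2)]
  simp only [map_sub, map_add, map_smul, map_neg, LinearMap.sub_apply,
    LinearMap.smul_apply, smul_eq_mul, hK.1 _ hd, sw, sw', h11, h22, h12]
  have hL := capLam_sq s
  linear_combination (1 / 2 * capLam s * s * γ.A s) * (capLam s ^ 2 - s ^ 2 + 1) * hL

/-- The origin of `B`: the derivative of `ω(ξ₁, ξ₂) = ½ Λ s A` along the axis equals `ω([ξ₁, ξ₂],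
∂/∂s)`, and both arguments are multiples of `P τ₃` up to a factor `i`. So the squared length of `P
τ₃` is `2 Λ (½ Λ s A)'`. -/
theorem IsKahler.val_axis_two (hK : γ.IsKahler) (hG : γ.IsInvariant) {s : ℝ} (hs : s ≠ 0) :
    γ.val (boost (axis s)) (boost (axis s) * pauli 2) (boost (axis s) * pauli 2) =
      4 * coeffB γ.A s := by
  have h := hK.hasDerivAt_val_gen hG (L := fun t => boost (axis t)) (det_boost_ne_zero (axis s))
    (hasDerivAt_boost_axis s) 0 1
  have h1 : HasDerivAt (fun t => 1 / 2 * (capLam t * t * γ.A t)) _ s :=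
    (((hasDerivAt_capLam s).mul (hasDerivAt_id s)).mul
      (γ.differentiableAt_A s).hasDerivAt).const_mul (1 / 2)
  have h2 := h.unique (h1.congr_of_eventuallyEq (by
    filter_upwards [isOpen_ne.mem_nhds hs] with t ht using hK.val_axis_gen hG ht))
  have e1 : Complex.I • (-gen 2 * boost (axis s)) = (1 / 2 : ℝ) • (pauli 2 * boost (axis s)) := by
    rw [gen, neg_mul, smul_neg, Matrix.smul_mul, smul_smul, ← neg_smul,
      ← smul_one_smul ℂ (1 / 2 : ℝ)]
    congr 1
    apply Complex.ext <;> norm_num [Complex.div_re, Complex.div_im]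
  rw [gen_comm_01, e1, pauli_two_mul_boost] at h2
  simp only [map_smul, LinearMap.smul_apply, smul_eq_mul, id] at h2
  have hp := capLam_pos s
  rw [coeffB]
  field_simp at h2
  simp only [Pi.mul_apply, id] at h2
  linear_combination h2

theorem A_pos (γ : RatMetric) (s : ℝ) : 0 < γ.A s := by
  refine γ.pos _ (det_boost_ne_zero _) _ fun c hc => ?_
  rw [velocity_eq, boost_axis] at hc
  have h01 := congrFun (congrFun hc 0) 1
  simp [pauli, Matrix.add_apply] at h01

theorem IsKahler.coeffB_pos (hK : γ.IsKahler) (hG : γ.IsInvariant) {s : ℝ} (hs : s ≠ 0) :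
    0 < coeffB γ.A s := by
  have h := (γ.gram_posDef (det_boost_ne_zero (axis s))).diag_pos (i := Sum.inl 2)
  rw [gram_apply, mul_chartDir_inl, hK.val_axis_two hG hs] at h
  linarith

end RatMetric

/-! ### Rotations -/

/-- The matrix `x₀ + i (x₁ τ₁ + x₂ τ₂)`. -/
def quat (x : Fin 3 → ℝ) : Mat2 :=
  !![(x 0 : ℂ), x 1 * Complex.I + x 2; x 1 * Complex.I - x 2, (x 0 : ℂ)]

/-- The frame obtained by rotation with `quat x`. -/
def quatFrame (x : Fin 3 → ℝ) : Fin 3 → Fin 3 → ℝ :=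
  ![![x 0 ^ 2 + x 1 ^ 2 - x 2 ^ 2, 2 * x 1 * x 2, 2 * x 0 * x 2],
    ![2 * x 1 * x 2, x 0 ^ 2 - x 1 ^ 2 + x 2 ^ 2, -2 * x 0 * x 1],
    ![-2 * x 0 * x 2, 2 * x 0 * x 1, x 0 ^ 2 - x 1 ^ 2 - x 2 ^ 2]]

theorem quat_mem {x : Fin 3 → ℝ} (hx : x 0 ^ 2 + x 1 ^ 2 + x 2 ^ 2 = 1) :
    quat x ∈ Matrix.specialUnitaryGroup (Fin 2) ℂ := by
  rw [Matrix.mem_specialUnitaryGroup_iff, Matrix.mem_unitaryGroup_iff]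
  have hx' : (x 0 : ℂ) ^ 2 + (x 1 : ℂ) ^ 2 + (x 2 : ℂ) ^ 2 = 1 := by exact_mod_cast hx
  have hI := Complex.I_mul_I
  constructor
  · ext i j
    fin_cases i <;> fin_cases j <;> simp [quat, Matrix.mul_apply, Fin.sum_univ_two] <;> grind
  · simp [quat, Matrix.det_fin_two]
    grind

theorem quat_mul_pauli {x : Fin 3 → ℝ} (hx : x 0 ^ 2 + x 1 ^ 2 + x 2 ^ 2 = 1) (a : Fin 3) :
    quat x * pauli a = tau (quatFrame x a) * quat x := by
  have hx' : (x 0 : ℂ) ^ 2 + (x 1 : ℂ) ^ 2 + (x 2 : ℂ) ^ 2 = 1 := by exact_mod_cast hx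
  have hI := Complex.I_mul_I
  have hx'' : (x 0 : ℂ) ^ 2 = 1 - (x 1 : ℂ) ^ 2 - (x 2 : ℂ) ^ 2 := by linear_combination hx'
  -- Inserting the factor `|x|² = 1` makes both sides homogeneous of degree three, so the claim
  -- becomes a polynomial identity.
  have h : quat x * pauli a = (((x 0 ^ 2 + x 1 ^ 2 + x 2 ^ 2 : ℝ)) : ℂ) • (quat x * pauli a) := by
    rw [hx, Complex.ofReal_one, one_smul]
  rw [h, tau_eq]
  ext i j
  fin_cases a <;> fin_cases i <;> fin_cases j <;>
    simp [quat, quatFrame, pauli, Matrix.mul_apply, Fin.sum_univ_two] <;> ring_nf <;>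
    simp only [Complex.I_sq] <;> ring

/-- A unit quaternion without `τ₃` component suffices to carry the third axis to `n`. Its real part
is the half-angle cosine `√((1 + n₃)/2)`; the antipode `n₃ = -1` needs a half turn. -/
theorem exists_rotation {n : Fin 3 → ℝ} (hn : n ⬝ᵥ n = 1) :
    ∃ (V : SU2) (w : Fin 3 → Fin 3 → ℝ), w 2 = n ∧
      (∀ a, V.1 * pauli a = tau (w a) * V.1) ∧
      (∀ a b, ∑ k, w k a * w k b = if a = b then 1 else 0) ∧ w 0 ⨯₃ w 1 = w 2 := by
  have hn' : n 0 ^ 2 + n 1 ^ 2 + n 2 ^ 2 = 1 := by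
    rw [← hn]
    simp [dotProduct, Fin.sum_univ_three]
    ring
  suffices ∃ x : Fin 3 → ℝ, x 0 ^ 2 + x 1 ^ 2 + x 2 ^ 2 = 1 ∧ quatFrame x 2 = n by
    obtain ⟨x, hx, hxn⟩ := this
    have hx2 : x 0 ^ 2 = 1 - x 1 ^ 2 - x 2 ^ 2 := by linarith
    refine ⟨⟨quat x, quat_mem hx⟩, quatFrame x, hxn, quat_mul_pauli hx, fun a b => ?_, ?_⟩
    · fin_cases a <;> fin_cases b <;> simp [quatFrame, Fin.sum_univ_three] <;> grind
    · ext i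
      rw [cross_apply]
      fin_cases i <;> simp [quatFrame] <;> grind
  by_cases h : n 2 = -1
  · refine ⟨![0, 1, 0], by simp, ?_⟩
    have h0 : n 0 = 0 := by nlinarith
    have h1 : n 1 = 0 := by nlinarith
    ext i
    fin_cases i <;> simp [quatFrame, h0, h1, h]
  · have hpos : 0 < (1 + n 2) / 2 := by
      have : -1 ≤ n 2 := by nlinarith
      have := lt_of_le_of_ne this (Ne.symm h)
      linarith
    set p := √((1 + n 2) / 2) with hp
    have hp0 : 0 < p := Real.sqrt_pos.2 hpos
    have hp2 : p ^ 2 = (1 + n 2) / 2 := Real.sq_sqrt hpos.le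
    have key : (n 1 / (2 * p)) ^ 2 + (-n 0 / (2 * p)) ^ 2 = 1 - p ^ 2 := by
      rw [div_pow, div_pow, ← add_div, div_eq_iff (by positivity), mul_pow, hp2]
      linear_combination hn'
    refine ⟨![p, n 1 / (2 * p), -n 0 / (2 * p)], ?_, ?_⟩
    · simp only [Matrix.cons_val_zero, Matrix.cons_val_one, Matrix.cons_val]
      linarith
    · ext i
      fin_cases i
      · simp [quatFrame]; field_simp
      · simp [quatFrame]; field_simp
      · simp [quatFrame]; linarith

/-! ### The metric and its inverse at a general point -/

theorem pauli_eq_sum_frame {w : Fin 3 → Fin 3 → ℝ}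
    (hw : ∀ a b, ∑ k, w k a * w k b = if a = b then 1 else 0) (a : Fin 3) :
    pauli a = ∑ k, w k a • tau (w k) := by
  simp only [tau, Finset.smul_sum, smul_smul]
  rw [Finset.sum_comm]
  simp only [← Finset.sum_smul, hw]
  simp

/-- The matrix `ε_{abc} l_c`. -/
def crossMat (l : Fin 3 → ℝ) : Matrix (Fin 3) (Fin 3) ℝ :=
  !![0, l 2, -l 1; -l 2, 0, l 0; l 1, -l 0, 0]

/-- The block matrix with the real part `α 1 + β l lᵀ` and the imaginary part `κ ε_{abc} l_c`. -/
def hermBlock (l : Fin 3 → ℝ) (α β κ : ℝ) : Matrix (Fin 3 ⊕ Fin 3) (Fin 3 ⊕ Fin 3) ℝ :=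
  Matrix.fromBlocks (α • 1 + β • Matrix.vecMulVec l l) (κ • crossMat l) (-(κ • crossMat l))
    (α • 1 + β • Matrix.vecMulVec l l)

theorem vecMulVec_mul_crossMat (l : Fin 3 → ℝ) : Matrix.vecMulVec l l * crossMat l = 0 := by
  ext i j
  fin_cases i <;> fin_cases j <;>
    simp [crossMat, Matrix.mul_apply, Fin.sum_univ_three, Matrix.vecMulVec_apply] <;> ring

theorem crossMat_mul_vecMulVec (l : Fin 3 → ℝ) : crossMat l * Matrix.vecMulVec l l = 0 := by
  ext i j
  fin_cases i <;> fin_cases j <;>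
    simp [crossMat, Matrix.mul_apply, Fin.sum_univ_three, Matrix.vecMulVec_apply] <;> ring

theorem crossMat_mul_self (l : Fin 3 → ℝ) :
    crossMat l * crossMat l = Matrix.vecMulVec l l - (l ⬝ᵥ l) • 1 := by
  ext i j
  fin_cases i <;> fin_cases j <;>
    simp [crossMat, Matrix.mul_apply, Fin.sum_univ_three, Matrix.vecMulVec_apply, dotProduct] <;>
    ring

theorem vecMulVec_mul_self (l : Fin 3 → ℝ) :
    Matrix.vecMulVec l l * Matrix.vecMulVec l l = (l ⬝ᵥ l) • Matrix.vecMulVec l l := by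
  ext i j
  fin_cases i <;> fin_cases j <;>
    simp [Matrix.mul_apply, Fin.sum_univ_three, Matrix.vecMulVec_apply, dotProduct] <;>
    ring

/-- With `K = crossMat l`, the relations `K l lᵀ = l lᵀ K = 0` and `K² = l lᵀ - |l|²` close the span
of `1`, `l lᵀ`, `K` under multiplication, so inversion reduces to three scalar equations. -/
theorem hermBlock_mul_hermBlock {l : Fin 3 → ℝ} {α β κ α' β' κ' : ℝ}
    (h1 : α * α' + κ * κ' * (l ⬝ᵥ l) = 1)
    (h2 : α * β' + β * α' + β * β' * (l ⬝ᵥ l) - κ * κ' = 0) (h3 : α * κ' + κ * α' = 0) :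
    hermBlock l α β κ * hermBlock l α' β' κ' = 1 := by
  have e1 : (α • (1 : Matrix (Fin 3) (Fin 3) ℝ) + β • Matrix.vecMulVec l l) *
      (α' • 1 + β' • Matrix.vecMulVec l l) - (κ • crossMat l) * (κ' • crossMat l) = 1 := by
    simp only [add_mul, mul_add, Matrix.smul_mul, Matrix.mul_smul, Matrix.one_mul, Matrix.mul_one,
      crossMat_mul_self, vecMulVec_mul_self]
    trans (α * α' + κ * κ' * (l ⬝ᵥ l)) • (1 : Matrix (Fin 3) (Fin 3) ℝ) +
      (α * β' + β * α' + β * β' * (l ⬝ᵥ l) - κ * κ') • Matrix.vecMulVec l l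
    · module
    · rw [h1, h2, one_smul, zero_smul, add_zero]
  have e2 : (α • (1 : Matrix (Fin 3) (Fin 3) ℝ) + β • Matrix.vecMulVec l l) * (κ' • crossMat l) +
      (κ • crossMat l) * (α' • 1 + β' • Matrix.vecMulVec l l) = 0 := by
    simp only [add_mul, mul_add, Matrix.smul_mul, Matrix.mul_smul, Matrix.one_mul, Matrix.mul_one,
      crossMat_mul_vecMulVec, vecMulVec_mul_crossMat]
    trans (α * κ' + κ * α') • crossMat l
    · module
    · rw [h3, zero_smul]
  rw [hermBlock, hermBlock, Matrix.fromBlocks_multiply, ← Matrix.fromBlocks_one]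
  refine Matrix.fromBlocks_inj.2 ⟨?_, e2, ?_, ?_⟩
  · rw [mul_neg, ← sub_eq_add_neg, e1]
  · rw [neg_mul, mul_neg, ← neg_add, add_comm, e2, neg_zero]
  · rw [neg_mul, add_comm, ← sub_eq_add_neg, e1]

namespace RatMetric

variable {γ : RatMetric}

theorem SU2_mul_boost_axis {V : SU2} {w : Fin 3 → Fin 3 → ℝ} {l : Fin 3 → ℝ}
    (hl : w 2 = (len l)⁻¹ • l) (hl0 : l ≠ 0) (hV : ∀ a, V.1 * pauli a = tau (w a) * V.1) :
    V.1 * boost (axis (len l)) = boost l * V.1 := by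
  have h : tau l = len l • tau (w 2) := by
    rw [hl, ← tau_smul, smul_smul, mul_inv_cancel₀ (len_pos hl0).ne', one_smul]
  rw [boost_axis, boost_eq_tau, h, mul_add, add_mul, Matrix.mul_smul, Matrix.mul_smul,
    Matrix.smul_mul, Matrix.smul_mul, hV, Matrix.mul_one, Matrix.one_mul]

theorem IsInvariant.val_frame (hG : γ.IsInvariant) {V : SU2} {w : Fin 3 → Fin 3 → ℝ}
    {l : Fin 3 → ℝ} (hl : w 2 = (len l)⁻¹ • l) (hl0 : l ≠ 0)
    (hV : ∀ a, V.1 * pauli a = tau (w a) * V.1) (a b : Fin 3) :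
    γ.val (boost l) (boost l * tau (w a)) (boost l * tau (w b)) =
      γ.val (boost (axis (len l))) (boost (axis (len l)) * pauli a)
        (boost (axis (len l)) * pauli b) ∧
    γ.val (boost l) (boost l * tau (w a)) (Complex.I • (boost l * tau (w b))) =
      γ.val (boost (axis (len l))) (boost (axis (len l)) * pauli a)
        (Complex.I • (boost (axis (len l)) * pauli b)) := by
  have h := SU2_mul_boost_axis hl hl0 hV
  have hX : ∀ a, V.1 * (boost (axis (len l)) * pauli a) = boost l * tau (w a) * V.1 := fun a => by
    rw [← Matrix.mul_assoc, h, Matrix.mul_assoc, hV, ← Matrix.mul_assoc]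
  have hd := det_boost_ne_zero (axis (len l))
  refine ⟨hG.val_conj V hd h (hX a) (hX b), hG.val_conj V hd h (hX a) ?_⟩
  rw [Matrix.mul_smul, hX, Matrix.smul_mul]

/-- Left invariance removes `U`, and a rotation carries the axis to `l`. In the rotated frame the
real part is diagonal with entries `h, h, 4B`, that is `h 1 + (4B - h) n nᵀ`, and the imaginary part
is a multiple of `w₀ ∧ w₁`. -/
theorem IsKahler.gram_polar (hK : γ.IsKahler) (hG : γ.IsInvariant) (U : SU2) {l : Fin 3 → ℝ}
    (hl : l ≠ 0) :
    γ.gram (U.1 * boost l) =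
      hermBlock l ((capLam (len l) ^ 2 + len l ^ 2) * γ.A (len l))
        ((4 * coeffB γ.A (len l) - (capLam (len l) ^ 2 + len l ^ 2) * γ.A (len l)) / len l ^ 2)
        (2 * capLam (len l) * γ.A (len l)) := by
  have hs := (len_pos hl).ne'
  have hn : ((len l)⁻¹ • l) ⬝ᵥ ((len l)⁻¹ • l) = 1 := by
    rw [smul_dotProduct, dotProduct_smul, ← len_sq, smul_eq_mul, smul_eq_mul]
    field_simp
  obtain ⟨V, w, hw2, hV, hw, hwc⟩ := exists_rotation hn
  have hd := det_boost_ne_zero l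
  have hda := det_boost_ne_zero (axis (len l))
  obtain ⟨h00, h11, k01⟩ := hK.val_axis hG hs
  obtain ⟨h01, h02, h12, k2⟩ := hK.val_axis_offdiag hG hs
  have h22 := hK.val_axis_two hG hs
  have h10 := (γ.symm _ hda _ _).trans h01
  have h20 := (γ.symm _ hda _ _).trans h02
  have h21 := (γ.symm _ hda _ _).trans h12
  have k10 := hK.val_I_right hda (boost (axis (len l)) * pauli 1) (boost (axis (len l)) * pauli 0)
  have k02 := hK.val_I_right hda (boost (axis (len l)) * pauli 0) (boost (axis (len l)) * pauli 2)
  have k12 := hK.val_I_right hda (boost (axis (len l)) * pauli 1) (boost (axis (len l)) * pauli 2)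
  have hexp : ∀ a, boost l * pauli a = ∑ k, w k a • (boost l * tau (w k)) := fun a => by
    rw [pauli_eq_sum_frame hw a, Finset.mul_sum]
    simp only [Matrix.mul_smul]
  have hreal : ∀ a b, γ.val (boost l) (boost l * pauli a) (boost l * pauli b) =
      (capLam (len l) ^ 2 + len l ^ 2) * γ.A (len l) * (if a = b then 1 else 0) +
        (4 * coeffB γ.A (len l) - (capLam (len l) ^ 2 + len l ^ 2) * γ.A (len l)) *
          (w 2 a * w 2 b) := by
    intro a b
    rw [hexp a, hexp b, ← hw a b]
    simp only [Fin.sum_univ_three, map_add, map_smul, LinearMap.add_apply, LinearMap.smul_apply,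
      smul_eq_mul, (hG.val_frame hw2 hl hV _ _).1, h00, h01, h02, h10, h11, h12, h20, h21, h22]
    ring
  have himag : ∀ a b, γ.val (boost l) (boost l * pauli a) (Complex.I • (boost l * pauli b)) =
      2 * capLam (len l) * len l * γ.A (len l) * (w 0 a * w 1 b - w 1 a * w 0 b) := by
    intro a b
    rw [hexp a, hexp b]
    simp only [Fin.sum_univ_three, smul_add, smul_comm Complex.I, map_add, map_smul,
      LinearMap.add_apply, LinearMap.smul_apply,
      smul_eq_mul, (hG.val_frame hw2 hl hV _ _).2, k10, k02, k12, k2, k01, hK.val_I_self hda]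
    ring
  -- Uses `w₀ × w₁ = w₂ = l / |l|`.
  have hcross : ∀ a b, len l * (w 0 a * w 1 b - w 1 a * w 0 b) = crossMat l a b := by
    intro a b
    have e : ∀ i, len l * (w 0 ⨯₃ w 1) i = l i := fun i => by
      rw [hwc, hw2, Pi.smul_apply, smul_eq_mul, mul_inv_cancel_left₀ hs]
    have e0 := e 0
    have e1 := e 1
    have e2 := e 2
    simp [cross_apply] at e0 e1 e2
    fin_cases a <;> fin_cases b <;> simp [crossMat] <;> grind
  have hww : ∀ a b, w 2 a * w 2 b = l a * l b / len l ^ 2 := by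
    intro a b
    rw [hw2, Pi.smul_apply, Pi.smul_apply, smul_eq_mul, smul_eq_mul]
    field_simp
  have hr : ∀ a b, γ.val (boost l) (boost l * pauli a) (boost l * pauli b) =
      ((capLam (len l) ^ 2 + len l ^ 2) * γ.A (len l)) * (1 : Matrix (Fin 3) (Fin 3) ℝ) a b +
        ((4 * coeffB γ.A (len l) - (capLam (len l) ^ 2 + len l ^ 2) * γ.A (len l)) / len l ^ 2) *
          Matrix.vecMulVec l l a b := by
    intro a b
    rw [hreal, hww, Matrix.one_apply, Matrix.vecMulVec_apply]
    ring
  have hi : ∀ a b, γ.val (boost l) (boost l * pauli a) (Complex.I • (boost l * pauli b)) =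
      2 * capLam (len l) * γ.A (len l) * crossMat l a b := by
    intro a b
    rw [himag, ← hcross]
    ring
  ext i j
  obtain i | i := i <;> obtain j | j := j <;>
    simp only [gram_apply, mul_chartDir_inl, mul_chartDir_inr, Matrix.mul_assoc,
      hG.val_left U hd, hK.1 _ hd, hK.val_I_left hd, hr, hi, hermBlock,
      Matrix.fromBlocks_apply₁₁, Matrix.fromBlocks_apply₁₂, Matrix.fromBlocks_apply₂₁,
      Matrix.fromBlocks_apply₂₂, Matrix.add_apply, Matrix.smul_apply, Matrix.neg_apply,
      smul_eq_mul]

theorem IsKahler.inv_gram_polar (hK : γ.IsKahler) (hG : γ.IsInvariant) (U : SU2) {l : Fin 3 → ℝ}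
    (hl : l ≠ 0) :
    (γ.gram (U.1 * boost l))⁻¹ =
      hermBlock l ((capLam (len l) ^ 2 + len l ^ 2) / γ.A (len l))
        ((1 / (4 * coeffB γ.A (len l)) - (capLam (len l) ^ 2 + len l ^ 2) / γ.A (len l)) /
          len l ^ 2)
        (-(2 * capLam (len l)) / γ.A (len l)) := by
  have hs := (len_pos hl).ne'
  have hA := (γ.A_pos (len l)).ne'
  have hB := (hK.coeffB_pos hG hs).ne'
  have hc := capLam_sq (len l)
  rw [hK.gram_polar hG U hl]
  refine Matrix.inv_eq_right_inv (hermBlock_mul_hermBlock ?_ ?_ ?_) <;> try rw [← len_sq]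
  all_goals field_simp
  · linear_combination (capLam (len l) ^ 2 - len l ^ 2 + 1) * hc
  · linear_combination (-(4 * γ.A (len l) * coeffB γ.A (len l))) * (capLam (len l) ^ 2 - len l ^ 2 + 1) * hc
  · ring

/-- The two off-diagonal blocks contribute equally, because `q` is symmetric and `crossMat l`
antisymmetric; hence `4 Λ / A`, twice the entry of the inverse. -/
theorem IsKahler.lapAt_polar (hK : γ.IsKahler) (hG : γ.IsInvariant) (u : Mat2 → ℝ) (U : SU2)
    {l : Fin 3 → ℝ} (hl : l ≠ 0) (q : Mat2 →ₗ[ℝ] Mat2 →ₗ[ℝ] ℝ)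
    (hq : ∀ X Y, q X Y = fderiv ℝ (fderiv ℝ u) (U.1 * boost l) (U.1 * X) (U.1 * Y))
    (hsymm : ∀ X Y, q X Y = q Y X) :
    γ.lapAt u (U.1 * boost l) =
      -((capLam (len l) ^ 2 + len l ^ 2) / γ.A (len l) *
          ∑ a, (q (boost l * pauli a) (boost l * pauli a) +
            q (Complex.I • (boost l * pauli a)) (Complex.I • (boost l * pauli a))) +
        (1 / (4 * coeffB γ.A (len l)) - (capLam (len l) ^ 2 + len l ^ 2) / γ.A (len l)) /
          len l ^ 2 * (q (boost l * tau l) (boost l * tau l) +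
            q (Complex.I • (boost l * tau l)) (Complex.I • (boost l * tau l))) -
        4 * capLam (len l) / γ.A (len l) * ∑ a, ∑ b, crossMat l a b *
          q (boost l * pauli a) (Complex.I • (boost l * pauli b))) := by
  have ht : boost l * tau l = ∑ a, l a • (boost l * pauli a) := by
    simp only [tau, Finset.mul_sum, Matrix.mul_smul]
  rw [lapAt, hK.inv_gram_polar hG U hl, ht]
  simp only [Fintype.sum_sum_type, mul_chartDir_inl, mul_chartDir_inr, Matrix.mul_assoc,
    ← hq, hermBlock, Matrix.fromBlocks_apply₁₁, Matrix.fromBlocks_apply₁₂,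
    Matrix.fromBlocks_apply₂₁, Matrix.fromBlocks_apply₂₂, Matrix.add_apply, Matrix.smul_apply,
    Matrix.neg_apply, smul_eq_mul, Matrix.vecMulVec_apply]
  generalize boost l = P
  have hz : ∀ a b, q (Complex.I • (P * pauli a)) (P * pauli b) =
    q (P * pauli b) (Complex.I • (P * pauli a)) := fun a b => hsymm _ _
  have h10 := hsymm (P * pauli 1) (P * pauli 0)
  have h20 := hsymm (P * pauli 2) (P * pauli 0)
  have h21 := hsymm (P * pauli 2) (P * pauli 1)
  have k10 := hsymm (Complex.I • (P * pauli 1)) (Complex.I • (P * pauli 0))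
  have k20 := hsymm (Complex.I • (P * pauli 2)) (Complex.I • (P * pauli 0))
  have k21 := hsymm (Complex.I • (P * pauli 2)) (Complex.I • (P * pauli 1))
  simp only [Fin.sum_univ_three, smul_add, smul_comm Complex.I, map_add, map_smul,
    LinearMap.add_apply, LinearMap.smul_apply, smul_eq_mul, hz, h10, h20, h21, k10, k20, k21]
  simp [crossMat]
  ring

end RatMetric

/-! ### The invariant vector fields in terms of derivatives on the space of matrices -/

theorem IsCnOnGL.hasDerivAt_comp {u : Mat2 → ℝ} (hu : IsCnOnGL 2 u) {L : ℝ → Mat2} {L' : Mat2}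
    {t : ℝ} (hdet : (L t).det ≠ 0) (hL : HasDerivAt L L' t) :
    HasDerivAt (fun s => u (L s)) (fderiv ℝ u (L t) L') t :=
  HasFDerivAt.comp_hasDerivAt (l := u) (l' := fderiv ℝ u (L t)) t
    (hu.differentiableAt hdet).hasFDerivAt hL

theorem IsCnOnGL.hasDerivAt_fderiv_comp {u : Mat2 → ℝ} (hu : IsCnOnGL 2 u) {L X : ℝ → Mat2}
    {L' X' : Mat2} {t : ℝ} (hdet : (L t).det ≠ 0) (hL : HasDerivAt L L' t)
    (hX : HasDerivAt X X' t) :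
    HasDerivAt (fun s => fderiv ℝ u (L s) (X s))
      (fderiv ℝ (fderiv ℝ u) (L t) L' (X t) + fderiv ℝ u (L t) X') t := by
  have h : HasDerivAt (fun s => fderiv ℝ u (L s)) (fderiv ℝ (fderiv ℝ u) (L t) L') t :=
    HasFDerivAt.comp_hasDerivAt (l := fderiv ℝ u) (l' := fderiv ℝ (fderiv ℝ u) (L t)) t
      (hu.differentiableAt_fderiv hdet).hasFDerivAt hL
  exact h.clm_apply hX

theorem det_polar_ne_zero (V : SU2) (m : Fin 3 → ℝ) : (V.1 * boost m).det ≠ 0 := by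
  rw [det_SU2_mul]
  exact det_boost_ne_zero m

/-- The derivative of `u` at `V boost m` in the direction `V X(m)`. -/
def fieldD (u : Mat2 → ℝ) (X : (Fin 3 → ℝ) → Mat2) : SU2 → (Fin 3 → ℝ) → ℝ :=
  fun V m => fderiv ℝ u (V.1 * boost m) (V.1 * X m)

/-- The partial derivatives of `boost`. -/
def dBoost (a : Fin 3) (m : Fin 3 → ℝ) : Mat2 := (m a / capLam (len m)) • (1 : Mat2) + pauli a

theorem hasDerivAt_add_smul_single (a : Fin 3) (m : Fin 3 → ℝ) :
    HasDerivAt (fun t : ℝ => m + t • Pi.single a 1) (Pi.single a 1) 0 := by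
  simpa using ((hasDerivAt_id (0 : ℝ)).smul_const (Pi.single a (1 : ℝ))).const_add m

theorem hasDerivAt_boost_single (a : Fin 3) (m : Fin 3 → ℝ) :
    HasDerivAt (fun t : ℝ => boost (m + t • Pi.single a 1)) (dBoost a m) 0 := by
  have h := hasDerivAt_boost (hasDerivAt_add_smul_single a m)
  simpa [tau_single, dBoost] using h

section Fields

variable {u : Mat2 → ℝ}

theorem IsCnOnGL.thetaD_comp (hu : IsCnOnGL 2 u) (a : Fin 3) :
    thetaD a (fun V m => u (V.1 * boost m)) = fieldD u fun m => gen a * boost m := by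
  funext V m
  have h := hu.hasDerivAt_comp (L := fun t => V.1 * ((oneParam a t).1 * boost m)) (t := 0)
    (by rw [det_SU2_mul, det_SU2_mul]; exact det_boost_ne_zero m)
    (hasDerivAt_const_mul_matrix V.1 (hasDerivAt_matrix_mul_const (boost m)
      (hasDerivAt_oneParam a)))
  rw [oneParam_zero, Matrix.one_mul] at h
  simp only [thetaD, Submonoid.coe_mul, Matrix.mul_assoc]
  exact h.deriv

/-- The flow moves both the base point and the transported vector `V X(m)`, which produces the
first-order term. -/
theorem IsCnOnGL.thetaD_fieldD (hu : IsCnOnGL 2 u) (a : Fin 3) (X : (Fin 3 → ℝ) → Mat2) (V : SU2)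
    (m : Fin 3 → ℝ) :
    thetaD a (fieldD u X) V m =
      fderiv ℝ (fderiv ℝ u) (V.1 * boost m) (V.1 * (gen a * boost m)) (V.1 * X m) +
        fderiv ℝ u (V.1 * boost m) (V.1 * (gen a * X m)) := by
  have h := hu.hasDerivAt_fderiv_comp (L := fun t => V.1 * ((oneParam a t).1 * boost m)) (t := 0)
    (by rw [det_SU2_mul, det_SU2_mul]; exact det_boost_ne_zero m)
    (hasDerivAt_const_mul_matrix V.1 (hasDerivAt_matrix_mul_const (boost m)
      (hasDerivAt_oneParam a)))
    (hasDerivAt_const_mul_matrix V.1 (hasDerivAt_matrix_mul_const (X m)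
      (hasDerivAt_oneParam a)))
  simp only [oneParam_zero, Matrix.one_mul] at h
  simp only [thetaD, fieldD, Submonoid.coe_mul, Matrix.mul_assoc]
  exact h.deriv

theorem IsCnOnGL.partialD_comp (hu : IsCnOnGL 2 u) (a : Fin 3) :
    partialD a (fun V m => u (V.1 * boost m)) = fieldD u (dBoost a) := by
  funext V m
  have h := hu.hasDerivAt_comp (L := fun t => V.1 * boost (m + t • Pi.single a 1)) (t := 0)
    (det_polar_ne_zero V _) (hasDerivAt_const_mul_matrix V.1 (hasDerivAt_boost_single a m))
  rw [zero_smul, add_zero] at h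
  exact h.deriv

theorem IsCnOnGL.partialD_fieldD (hu : IsCnOnGL 2 u) (a : Fin 3) {X : (Fin 3 → ℝ) → Mat2}
    (V : SU2) {m : Fin 3 → ℝ} {X' : Mat2}
    (hX : HasDerivAt (fun t : ℝ => X (m + t • Pi.single a 1)) X' 0) :
    partialD a (fieldD u X) V m =
      fderiv ℝ (fderiv ℝ u) (V.1 * boost m) (V.1 * dBoost a m) (V.1 * X m) +
        fderiv ℝ u (V.1 * boost m) (V.1 * X') := by
  have h := hu.hasDerivAt_fderiv_comp (L := fun t => V.1 * boost (m + t • Pi.single a 1)) (t := 0)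
    (det_polar_ne_zero V _) (hasDerivAt_const_mul_matrix V.1 (hasDerivAt_boost_single a m))
    (hasDerivAt_const_mul_matrix V.1 hX)
  simp only [zero_smul, add_zero] at h
  exact h.deriv

theorem IsCnOnGL.partialD_thetaD_comp (hu : IsCnOnGL 2 u) (a b : Fin 3) (V : SU2)
    (m : Fin 3 → ℝ) :
    partialD b (thetaD a fun V m => u (V.1 * boost m)) V m =
      fderiv ℝ (fderiv ℝ u) (V.1 * boost m) (V.1 * dBoost b m) (V.1 * (gen a * boost m)) +
        fderiv ℝ u (V.1 * boost m) (V.1 * (gen a * dBoost b m)) := by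
  rw [hu.thetaD_comp]
  exact hu.partialD_fieldD b V (hasDerivAt_const_mul_matrix _ (hasDerivAt_boost_single b m))

theorem sum_smul_gen (l : Fin 3 → ℝ) : ∑ a, l a • gen a = (Complex.I / 2) • tau l := by
  simp only [gen, tau, Finset.smul_sum, smul_comm (Complex.I / 2)]

theorem IsCnOnGL.lamTheta_comp (hu : IsCnOnGL 2 u) :
    lamTheta (fun V m => u (V.1 * boost m)) =
      fieldD u fun m => (Complex.I / 2) • tau m * boost m := by
  funext V m
  simp only [lamTheta, hu.thetaD_comp, fieldD, ← sum_smul_gen, Finset.sum_mul, Finset.mul_sum,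
    Matrix.smul_mul, Matrix.mul_smul, map_sum, map_smul, smul_eq_mul]

theorem IsCnOnGL.lamTheta_fieldD (hu : IsCnOnGL 2 u) (X : (Fin 3 → ℝ) → Mat2) (V : SU2)
    (m : Fin 3 → ℝ) :
    lamTheta (fieldD u X) V m =
      fderiv ℝ (fderiv ℝ u) (V.1 * boost m) (V.1 * ((Complex.I / 2) • tau m * boost m))
          (V.1 * X m) +
        fderiv ℝ u (V.1 * boost m) (V.1 * ((Complex.I / 2) • tau m * X m)) := by
  simp only [lamTheta, hu.thetaD_fieldD, ← sum_smul_gen, Finset.sum_mul, Finset.mul_sum,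
    Matrix.smul_mul, Matrix.mul_smul, map_sum, map_smul, smul_eq_mul, mul_add,
    Finset.sum_add_distrib, _root_.sum_apply, _root_.smul_apply]

/-- The velocity `e_a × m` of the rotation about the axis `a`. -/
def rotVec (a : Fin 3) (m : Fin 3 → ℝ) : Fin 3 → ℝ := ![![0, -m 2, m 1], ![m 2, 0, -m 0],
  ![-m 1, m 0, 0]] a

/-- Rotations preserve `|m|`: the multiples of `1` in `dBoost` are proportional to `m` and cancel in
`m × ∂`. -/
theorem IsCnOnGL.angularD_comp (hu : IsCnOnGL 2 u) (a : Fin 3) :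
    angularD a (fun V m => u (V.1 * boost m)) = fieldD u fun m => tau (rotVec a m) := by
  funext V m
  simp only [angularD, hu.partialD_comp, fieldD, cross_apply]
  fin_cases a <;>
  · simp only [rotVec, tau, dBoost, Fin.sum_univ_three, Fin.zero_eta, Fin.mk_one, Fin.reduceFinMk,
      Matrix.cons_val_zero, Matrix.cons_val_one, Matrix.cons_val, mul_add, Matrix.mul_smul,
      map_add, map_smul, smul_eq_mul]
    ring

theorem rotVec_add_smul (a : Fin 3) (m x : Fin 3 → ℝ) (t : ℝ) :
    rotVec a (m + t • x) = rotVec a m + t • rotVec a x := by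
  fin_cases a <;> ext i <;> fin_cases i <;> simp [rotVec] <;> ring

theorem IsCnOnGL.angularD_fieldD (hu : IsCnOnGL 2 u) (a : Fin 3) (V : SU2) (m : Fin 3 → ℝ) :
    angularD a (fieldD u fun m => tau (rotVec a m)) V m =
      fderiv ℝ (fderiv ℝ u) (V.1 * boost m) (V.1 * tau (rotVec a m)) (V.1 * tau (rotVec a m)) +
        fderiv ℝ u (V.1 * boost m) (V.1 * tau (rotVec a (rotVec a m))) := by
  have h : ∀ b, partialD b (fieldD u fun m => tau (rotVec a m)) V m = _ := fun b =>
    hu.partialD_fieldD b V (X' := tau (rotVec a (Pi.single b 1))) (hasDerivAt_tau (by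
      simp only [rotVec_add_smul]
      simpa using ((hasDerivAt_id (0 : ℝ)).smul_const (rotVec a (Pi.single b 1))).const_add
        (rotVec a m)))
  simp only [angularD, h, cross_apply]
  generalize fderiv ℝ (fderiv ℝ u) (V.1 * boost m) = Q
  generalize fderiv ℝ u (V.1 * boost m) = D
  fin_cases a <;>
  · simp [rotVec, tau, dBoost, Fin.sum_univ_three, mul_add]
    ring

theorem len_smul_unit {l : Fin 3 → ℝ} (hl : l ≠ 0) {s : ℝ} (hs : 0 < s) :
    len (s • (len l)⁻¹ • l) = s := by
  have h := len_pos hl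
  rw [len, smul_smul, smul_dotProduct, dotProduct_smul, ← len_sq, smul_eq_mul, smul_eq_mul,
    Real.sqrt_eq_iff_mul_self_eq_of_pos hs]
  field_simp

/-- The derivative of `boost` along the ray in the direction of `n`. -/
def rayVelocity (n : Fin 3 → ℝ) (s : ℝ) : Mat2 := (s / capLam s) • (1 : Mat2) + tau n

theorem hasDerivAt_boost_ray {l : Fin 3 → ℝ} (hl : l ≠ 0) {s : ℝ} (hs : 0 < s) :
    HasDerivAt (fun t : ℝ => boost (t • (len l)⁻¹ • l)) (rayVelocity ((len l)⁻¹ • l) s) s := by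
  have h := hasDerivAt_boost ((hasDerivAt_id s).smul_const ((len l)⁻¹ • l))
  simp only [id, one_smul, len_smul_unit hl hs] at h
  refine h.congr_deriv ?_
  have hn := len_pos hl
  rw [rayVelocity]
  congr 3
  rw [smul_dotProduct, dotProduct_smul, smul_dotProduct, ← len_sq, smul_eq_mul, smul_eq_mul,
    smul_eq_mul]
  field_simp

theorem hasDerivAt_rayVelocity (n : Fin 3 → ℝ) (s : ℝ) :
    HasDerivAt (rayVelocity n) ((1 / capLam s ^ 3) • (1 : Mat2)) s := by
  have hp := capLam_pos s
  have h := ((hasDerivAt_id s).div (hasDerivAt_capLam s) hp.ne').smul_const (1 : Mat2)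
  refine (h.add_const (tau n)).congr_deriv ?_
  congr 1
  simp only [id]
  field_simp
  linear_combination capLam_sq s

theorem len_smul_unit_self {l : Fin 3 → ℝ} (hl : l ≠ 0) : len l • (len l)⁻¹ • l = l := by
  rw [smul_smul, mul_inv_cancel₀ (len_pos hl).ne', one_smul]

theorem IsCnOnGL.radialD_comp (hu : IsCnOnGL 2 u) (V : SU2) {l : Fin 3 → ℝ} (hl : l ≠ 0) :
    radialD (fun V m => u (V.1 * boost m)) V l =
      fderiv ℝ u (V.1 * boost l) (V.1 * rayVelocity ((len l)⁻¹ • l) (len l)) := by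
  have h := hu.hasDerivAt_comp (L := fun s => V.1 * boost (s • (len l)⁻¹ • l))
    (det_polar_ne_zero V _) (hasDerivAt_const_mul_matrix V.1 (hasDerivAt_boost_ray hl (len_pos hl)))
  rw [len_smul_unit_self hl] at h
  exact h.deriv

theorem IsCnOnGL.radialD_radialD (hu : IsCnOnGL 2 u) (V : SU2) {l : Fin 3 → ℝ} (hl : l ≠ 0)
    {k : ℝ → ℝ} {k' : ℝ} (hk : HasDerivAt k k' (len l)) :
    radialD (fun V m => k (len m) * radialD (fun V m => u (V.1 * boost m)) V m) V l =
      k' * fderiv ℝ u (V.1 * boost l) (V.1 * rayVelocity ((len l)⁻¹ • l) (len l)) +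
      k (len l) * (fderiv ℝ (fderiv ℝ u) (V.1 * boost l)
          (V.1 * rayVelocity ((len l)⁻¹ • l) (len l))
          (V.1 * rayVelocity ((len l)⁻¹ • l) (len l)) +
        fderiv ℝ u (V.1 * boost l) (V.1 * ((1 / capLam (len l) ^ 3) • (1 : Mat2)))) := by
  have hpos := len_pos hl
  have h := hk.mul (hu.hasDerivAt_fderiv_comp (L := fun s => V.1 * boost (s • (len l)⁻¹ • l))
    (det_polar_ne_zero V _) (hasDerivAt_const_mul_matrix V.1 (hasDerivAt_boost_ray hl hpos))
    (hasDerivAt_const_mul_matrix V.1 (hasDerivAt_rayVelocity ((len l)⁻¹ • l) (len l))))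
  simp only [len_smul_unit_self hl] at h
  refine (h.congr_of_eventuallyEq ?_).deriv
  -- The formula for the inner radial derivative requires a nonzero point, hence the restriction to
  -- `s > 0`.
  filter_upwards [isOpen_Ioi.mem_nhds (Set.mem_Ioi.2 hpos)] with s hs
  have hs : 0 < s := hs
  have hne : s • (len l)⁻¹ • l ≠ 0 := by
    intro h0
    have := len_smul_unit hl hs
    rw [h0] at this
    simp [len] at this
    exact hs.ne this
  rw [hu.radialD_comp V hne, len_smul_unit hl hs, inv_smul_smul₀ hs.ne']
  rfl

end Fields

/-! ### The second-order part -/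

set_option maxRecDepth 10000 in
set_option maxHeartbeats 1600000 in
-- This is the `B`-independent part of the equality of Hessian terms, cleared of denominators. Here
-- `p`, `d`, `v` stand for `2θ`, `∂`, `𝛌 × ∂` in the frame `y = P τ`, `z = i P τ`. The value of `k`
-- is irrelevant, since its term in `d` is parallel to `l` and drops out of `l · (d × p)`.
theorem trace_identity {E : Type*} [AddCommGroup E] [Module ℝ E] (q : E →ₗ[ℝ] E →ₗ[ℝ] ℝ)
    (hq : ∀ x y, q x y = q y x) (y z : Fin 3 → E) (l : Fin 3 → ℝ) {Λ k t c : ℝ}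
    (ht : t = l 0 ^ 2 + l 1 ^ 2 + l 2 ^ 2) (hc : c = 1 + 2 * t) (hΛ : Λ ^ 2 = 1 + t)
    (p d v : Fin 3 → E)
    (hp : ∀ a, p a = c • z a - (2 * l a) • ∑ b, l b • z b +
      (2 * Λ) • ∑ b, crossMat l a b • y b)
    (hd : ∀ a, d a = Λ • y a - (l a * k) • (∑ b, l b • y b) - ∑ b, crossMat l a b • z b)
    (hv : ∀ a, v a = l a • (∑ b, l b • z b) - t • z a - Λ • ∑ b, crossMat l a b • y b) :
    t * (∑ a, q (p a) (p a)) +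
        2 * t * (l 0 * (q (d 1) (p 2) - q (d 2) (p 1)) + l 1 * (q (d 2) (p 0) - q (d 0) (p 2)) +
          l 2 * (q (d 0) (p 1) - q (d 1) (p 0))) -
        q (∑ b, l b • z b) (∑ b, l b • z b) + c * ∑ a, q (v a) (v a) =
      (1 + t) * c * (t * (∑ a, (q (y a) (y a) + q (z a) (z a))) -
          (q (∑ b, l b • y b) (∑ b, l b • y b) + q (∑ b, l b • z b) (∑ b, l b • z b))) -
        4 * Λ * (1 + t) * t * ∑ a, ∑ b, crossMat l a b * q (y a) (z b) := by
  have hz : ∀ a b, q (z a) (y b) = q (y b) (z a) := fun a b => hq _ _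
  have h10 := hq (y 1) (y 0)
  have h20 := hq (y 2) (y 0)
  have h21 := hq (y 2) (y 1)
  have k10 := hq (z 1) (z 0)
  have k20 := hq (z 2) (z 0)
  have k21 := hq (z 2) (z 1)
  have e0 : ∀ x : Fin 3 → E, ∑ b, crossMat l 0 b • x b = l 2 • x 1 - l 1 • x 2 := fun x => by
    simp [crossMat, Fin.sum_univ_three, sub_eq_add_neg]
  have e1 : ∀ x : Fin 3 → E, ∑ b, crossMat l 1 b • x b = l 0 • x 2 - l 2 • x 0 := fun x => by
    simp [crossMat, Fin.sum_univ_three, sub_eq_neg_add]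
  have e2 : ∀ x : Fin 3 → E, ∑ b, crossMat l 2 b • x b = l 1 • x 0 - l 0 • x 1 := fun x => by
    simp [crossMat, Fin.sum_univ_three, sub_eq_add_neg]
  have hN : ∑ a, ∑ b, crossMat l a b * q (y a) (z b) =
      l 2 * (q (y 0) (z 1) - q (y 1) (z 0)) + l 0 * (q (y 1) (z 2) - q (y 2) (z 1)) +
        l 1 * (q (y 2) (z 0) - q (y 0) (z 2)) := by
    simp [crossMat, Fin.sum_univ_three]
    ring
  rw [hN]
  have p0 := hp 0
  have p1 := hp 1
  have p2 := hp 2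
  have d0 := hd 0
  have d1 := hd 1
  have d2 := hd 2
  have v0 := hv 0
  have v1 := hv 1
  have v2 := hv 2
  rw [e0] at p0 d0 v0
  rw [e1] at p1 d1 v1
  rw [e2] at p2 d2 v2
  simp only [p0, p1, p2, d0, d1, d2, v0, v1, v2, Fin.sum_univ_three, map_add, map_sub, map_smul,
    LinearMap.add_apply, LinearMap.sub_apply, LinearMap.smul_apply, smul_eq_mul, hz, h10, h20,
    h21, k10, k20, k21]
  subst hc ht
  -- The coefficient of `Λ²`: `c + 4t = 1 + 6t` from the squares of `v` and `p`, and `4t` from the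
  -- mixed term.
  linear_combination ((1 + 6 * (l 0 ^ 2 + l 1 ^ 2 + l 2 ^ 2)) *
      (l 2 ^ 2 * q (y 1) (y 1) - 2 * l 1 * l 2 * q (y 1) (y 2) + l 1 ^ 2 * q (y 2) (y 2) +
        (l 0 ^ 2 * q (y 2) (y 2) - 2 * l 0 * l 2 * q (y 0) (y 2) + l 2 ^ 2 * q (y 0) (y 0)) +
        (l 1 ^ 2 * q (y 0) (y 0) - 2 * l 0 * l 1 * q (y 0) (y 1) + l 0 ^ 2 * q (y 1) (y 1))) +
    4 * (l 0 ^ 2 + l 1 ^ 2 + l 2 ^ 2) *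
      (l 0 * (l 1 * q (y 0) (y 1) - l 0 * q (y 1) (y 1) - l 0 * q (y 2) (y 2) +
          l 2 * q (y 0) (y 2)) +
        l 1 * (l 2 * q (y 1) (y 2) - l 1 * q (y 2) (y 2) - l 1 * q (y 0) (y 0) +
          l 0 * q (y 0) (y 1)) +
        l 2 * (l 0 * q (y 0) (y 2) - l 2 * q (y 0) (y 0) - l 2 * q (y 1) (y 1) +
          l 1 * q (y 1) (y 2)))) * hΛ

/-! ### Matrix identities at `boost l` -/

section BoostIdentities

variable (l : Fin 3 → ℝ)

theorem len_sq_complex : (capLam (len l) : ℂ) ^ 2 = 1 + (l 0 ^ 2 + l 1 ^ 2 + l 2 ^ 2) := by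
  have h := capLam_sq (len l)
  rw [len_sq] at h
  have h' : capLam (len l) ^ 2 = 1 + (l 0 ^ 2 + l 1 ^ 2 + l 2 ^ 2) := by
    rw [h]
    simp [dotProduct, Fin.sum_univ_three]
    ring
  exact_mod_cast congrArg (fun x : ℝ => (x : ℂ)) h'

theorem boost_entries : boost l =
    !![(capLam (len l) : ℂ) + l 2, l 0 - l 1 * Complex.I; l 0 + l 1 * Complex.I,
      (capLam (len l) : ℂ) - l 2] := by
  rw [boost_eq_tau, tau_eq]
  ext i j
  fin_cases i <;> fin_cases j <;> simp [Matrix.add_apply]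
  ring

theorem boost_mul_tau_eq_sum : boost l * tau l = ∑ a, l a • (boost l * pauli a) := by
  simp only [tau, Finset.mul_sum, Matrix.mul_smul]

theorem tau_mul_boost : tau l * boost l = boost l * tau l := by
  simp [boost_eq_tau, add_mul, mul_add]

/-- This expansion and the next two write the fields `2θ_a`, `∂_a` and `(𝛌 × ∂)_a` in the frame `P
τ_b`, `i P τ_b`, as `trace_identity` requires. -/
theorem I_smul_pauli_mul_boost (a : Fin 3) :
    Complex.I • (pauli a * boost l) =
      (1 + 2 * (l 0 ^ 2 + l 1 ^ 2 + l 2 ^ 2)) • Complex.I • (boost l * pauli a) -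
        (2 * l a) • ∑ b, l b • Complex.I • (boost l * pauli b) +
        (2 * capLam (len l)) • ∑ b, crossMat l a b • (boost l * pauli b) := by
  have h := len_sq_complex l
  have hI := Complex.I_mul_I
  rw [boost_entries]
  ext i j
  fin_cases a <;> fin_cases i <;> fin_cases j <;>
    simp [pauli, crossMat, Fin.sum_univ_three, Matrix.add_apply] <;> grind

theorem dBoost_eq (a : Fin 3) :
    dBoost a l = capLam (len l) • (boost l * pauli a) -
      (l a * (capLam (len l))⁻¹) • (∑ b, l b • (boost l * pauli b)) -
      ∑ b, crossMat l a b • Complex.I • (boost l * pauli b) := by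
  have h := len_sq_complex l
  have hI := Complex.I_mul_I
  have hne : (capLam (len l) : ℂ) ≠ 0 := by exact_mod_cast (capLam_pos _).ne'
  have hinv := mul_inv_cancel₀ hne
  rw [boost_entries, dBoost, div_eq_mul_inv]
  ext i j
  fin_cases a <;> fin_cases i <;> fin_cases j <;>
    simp [pauli, crossMat, Fin.sum_univ_three, Matrix.add_apply] <;> grind

theorem tau_rotVec_eq (a : Fin 3) :
    tau (rotVec a l) = l a • (∑ b, l b • Complex.I • (boost l * pauli b)) -
      (l 0 ^ 2 + l 1 ^ 2 + l 2 ^ 2) • Complex.I • (boost l * pauli a) -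
      capLam (len l) • ∑ b, crossMat l a b • (boost l * pauli b) := by
  have h := len_sq_complex l
  have hI := Complex.I_mul_I
  rw [boost_entries, tau_eq]
  ext i j
  fin_cases a <;> fin_cases i <;> fin_cases j <;>
    simp [pauli, rotVec, crossMat, Fin.sum_univ_three] <;> grind

end BoostIdentities

/-! ### First-order terms and the radial direction -/

section FirstOrder

variable (l : Fin 3 → ℝ)

/-- The first-order contribution of `𝛌 · (∂ × θ)`; the multiples of `1` in `dBoost` cancel as in `𝛌
× 𝛌 = 0`. -/
theorem sum_cross_gen_dBoost :
    l 0 • (gen 2 * dBoost 1 l - gen 1 * dBoost 2 l) +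
      l 1 • (gen 0 * dBoost 2 l - gen 2 * dBoost 0 l) +
      l 2 • (gen 1 * dBoost 0 l - gen 0 * dBoost 1 l) = tau l := by
  have hI := Complex.I_mul_I
  rw [tau_eq]
  simp only [dBoost, mul_add, Matrix.mul_smul, Matrix.mul_one]
  generalize (capLam (len l)) = Λ
  ext i j
  fin_cases i <;> fin_cases j <;> simp [gen, pauli, Matrix.add_apply] <;> grind

theorem gen_mul_gen_mul (a : Fin 3) (M : Mat2) : gen a * (gen a * M) = (-1 / 4 : ℝ) • M := by
  have h : gen a * gen a = (-1 / 4 : ℝ) • (1 : Mat2) := by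
    have hI := Complex.I_mul_I
    ext i j
    fin_cases a <;> fin_cases i <;> fin_cases j <;> simp [gen, pauli] <;> grind
  rw [← Matrix.mul_assoc, h, Matrix.smul_mul, Matrix.one_mul]

theorem half_tau_mul_half_tau_mul (M : Mat2) :
    (Complex.I / 2) • tau l * ((Complex.I / 2) • tau l * M) =
      (-(l 0 ^ 2 + l 1 ^ 2 + l 2 ^ 2) / 4 : ℝ) • M := by
  have h : (Complex.I / 2) • tau l * (Complex.I / 2) • tau l =
      (-(l 0 ^ 2 + l 1 ^ 2 + l 2 ^ 2) / 4 : ℝ) • (1 : Mat2) := by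
    have hI := Complex.I_mul_I
    rw [tau_eq]
    ext i j
    fin_cases i <;> fin_cases j <;> simp <;> grind
  rw [← Matrix.mul_assoc, h, Matrix.smul_mul, Matrix.one_mul]

theorem sum_rotVec_rotVec : ∑ a, tau (rotVec a (rotVec a l)) = (-2 : ℝ) • tau l := by
  ext i j
  fin_cases i <;> fin_cases j <;> simp [tau_eq, rotVec, Fin.sum_univ_three, Matrix.add_apply] <;>
    ring

theorem gen_mul_boost (a : Fin 3) :
    gen a * boost l = (1 / 2 : ℝ) • Complex.I • (pauli a * boost l) := by
  rw [gen, Matrix.smul_mul, ← smul_assoc]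
  congr 1
  apply Complex.ext <;> norm_num [Complex.div_re, Complex.div_im]

theorem half_tau_mul_boost :
    (Complex.I / 2) • tau l * boost l = (1 / 2 : ℝ) • Complex.I • (boost l * tau l) := by
  rw [Matrix.smul_mul, ← smul_assoc, tau_mul_boost]
  congr 1
  apply Complex.ext <;> norm_num [Complex.div_re, Complex.div_im]

theorem boost_mul_tau : boost l * tau l = capLam (len l) • tau l + (len l ^ 2) • (1 : Mat2) := by
  have hI := Complex.I_mul_I
  have h : tau l * tau l = (len l ^ 2) • (1 : Mat2) := by
    rw [len_sq, tau_eq]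
    ext i j
    fin_cases i <;> fin_cases j <;> simp [dotProduct, Fin.sum_univ_three] <;> grind
  rw [boost_eq_tau, add_mul, h, Matrix.smul_mul, Matrix.one_mul]

variable {l}

theorem rayVelocity_eq (hl : l ≠ 0) : rayVelocity ((len l)⁻¹ • l) (len l) =
    (capLam (len l) * len l)⁻¹ • (boost l * tau l) := by
  have hs := (len_pos hl).ne'
  have hp := (capLam_pos (len l)).ne'
  rw [rayVelocity, boost_mul_tau, tau_smul, smul_add, smul_smul, smul_smul, add_comm]
  congr 2 <;> field_simp

end FirstOrder

/-- The scalar computation which eliminates the first-order terms. -/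
theorem scalar_identity {s Λ A A' B S₁ X yy zz vv T N d₁ dτ : ℝ} (hs : s ≠ 0) (hΛ0 : Λ ≠ 0)
    (hA : A ≠ 0) (hB0 : B ≠ 0) (hΛ : Λ ^ 2 = 1 + s ^ 2)
    (hB : B = 1 / 4 * (s ^ 2 + Λ ^ 2) * A + 1 / 4 * s * Λ ^ 2 * A') (hd : dτ = -(Λ * d₁))
    (hid : s ^ 2 * S₁ + 2 * s ^ 2 * X - zz + (1 + 2 * s ^ 2) * vv =
      (1 + s ^ 2) * (1 + 2 * s ^ 2) * (s ^ 2 * T - (yy + zz)) - 4 * Λ * (1 + s ^ 2) * s ^ 2 * N) :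
    -((Λ ^ 2 + s ^ 2) / A * T +
          (1 / (4 * B) - (Λ ^ 2 + s ^ 2) / A) / s ^ 2 * (yy + zz) - 4 * Λ / A * N) =
      -(4 / (Λ ^ 2 * A)) * (1 / 4 * S₁ + (1 / 2 * X + dτ) -
          1 / s ^ 2 * (1 - Λ ^ 2 * A / (4 * B)) * (1 / 4 * zz)) -
        1 / (Λ * s ^ 2 * A ^ 2 * B) *
          ((2 * s * Λ ^ 3 * A ^ 2 + 3 * s ^ 3 * Λ * A ^ 2 + 2 * s ^ 2 * Λ ^ 3 * A * A') / 4 *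
              (s / Λ * d₁ + dτ / s) +
            s ^ 2 * Λ ^ 3 * A ^ 2 / 4 * (yy / (Λ * s) ^ 2 + 1 / Λ ^ 3 * d₁)) -
        (Λ ^ 2 + s ^ 2) / (s ^ 2 * Λ ^ 2 * A) * (vv - 2 * dτ) := by
  -- The polynomial factor is the derivative of `s² Λ³ A² / 4`, multiplied by `Dr` for `r` the
  -- radial velocity. With `Dr = -d₁ / (Λ s)` the first-order part collects exactly `B`.
  have h1 : (2 * s * Λ ^ 3 * A ^ 2 + 3 * s ^ 3 * Λ * A ^ 2 + 2 * s ^ 2 * Λ ^ 3 * A * A') / 4 *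
      (s / Λ * d₁ + dτ / s) + s ^ 2 * Λ ^ 3 * A ^ 2 / 4 * (yy / (Λ * s) ^ 2 + 1 / Λ ^ 3 * d₁) =
      -(2 * A * B * d₁) + Λ * A ^ 2 / 4 * yy := by
    have h2 : s / Λ * d₁ + dτ / s = -(d₁ / (Λ * s)) := by
      rw [hd]
      field_simp
      linear_combination (-d₁) * hΛ
    rw [h2, hB]
    field_simp
    ring
  rw [h1, hd]
  have h3 : Λ ^ 2 + s ^ 2 = 1 + 2 * s ^ 2 := by linarith
  have h4 : S₁ = ((1 + s ^ 2) * (1 + 2 * s ^ 2) * (s ^ 2 * T - (yy + zz)) -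
      4 * Λ * (1 + s ^ 2) * s ^ 2 * N - 2 * s ^ 2 * X + zz - (1 + 2 * s ^ 2) * vv) / s ^ 2 := by
    rw [eq_div_iff (by positivity)]
    linarith
  have h5 : 1 + s ^ 2 = Λ ^ 2 := hΛ.symm
  rw [h3, h4, h5]
  field_simp
  ring

/-! ### Agreement of the trace form with the polar formula -/

namespace RatMetric

variable {γ : RatMetric}

/-- Euler's relation for a function homogeneous of degree zero. -/
theorem fderiv_self_eq_zero {u : Mat2 → ℝ} (hu : IsCnOnGL 2 u)
    (hs : ∀ (L : Mat2) (c : ℂ), c ≠ 0 → u (c • L) = u L) {L : Mat2} (hL : L.det ≠ 0) :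
    fderiv ℝ u L L = 0 := by
  have h1 : HasDerivAt (fun t : ℝ => t • L) L 1 := by
    simpa using (hasDerivAt_id (1 : ℝ)).smul_const L
  have h := hu.hasDerivAt_comp (by rwa [one_smul]) h1
  rw [one_smul] at h
  refine h.unique ((hasDerivAt_const (1 : ℝ) (u L)).congr_of_eventuallyEq ?_)
  filter_upwards [isOpen_ne.mem_nhds (one_ne_zero : (1 : ℝ) ≠ 0)] with t ht
  have := hs L (t : ℂ) (by exact_mod_cast ht)
  rwa [Complex.coe_smul] at this

theorem IsKahler.lapAt_eq_lapFormula (hK : γ.IsKahler) (hG : γ.IsInvariant) {u : Mat2 → ℝ}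
    (hu : IsCnOnGL 2 u) (hs : ∀ (L : Mat2) (c : ℂ), c ≠ 0 → u (c • L) = u L) (U : SU2)
    {l : Fin 3 → ℝ} (hl : l ≠ 0) :
    γ.lapAt u (U.1 * boost l) = lapFormula γ.A (fun V m => u (V.1 * boost m)) U l := by
  have hdet := det_polar_ne_zero U l
  have hlen := len_pos hl
  have hcap := capLam_pos (len l)
  have ht : len l ^ 2 = l 0 ^ 2 + l 1 ^ 2 + l 2 ^ 2 := by
    rw [len_sq]
    simp [dotProduct, Fin.sum_univ_three]
    ring
  let mulU : Mat2 →ₗ[ℝ] Mat2 := LinearMap.mulLeft ℝ U.1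
  let D : Mat2 →ₗ[ℝ] ℝ := (fderiv ℝ u (U.1 * boost l)).toLinearMap ∘ₗ mulU
  let q : Mat2 →ₗ[ℝ] Mat2 →ₗ[ℝ] ℝ := LinearMap.mk₂ ℝ
    (fun X Y => fderiv ℝ (fderiv ℝ u) (U.1 * boost l) (U.1 * X) (U.1 * Y))
    (fun X X' Y => by simp [mul_add]) (fun c X Y => by simp)
    (fun X Y Y' => by simp [mul_add]) (fun c X Y => by simp)
  have hD : ∀ X, fderiv ℝ u (U.1 * boost l) (U.1 * X) = D X := fun X => rfl
  have hq : ∀ X Y, fderiv ℝ (fderiv ℝ u) (U.1 * boost l) (U.1 * X) (U.1 * Y) = q X Y :=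
    fun X Y => rfl
  have hsymm : ∀ X Y, q X Y = q Y X := fun X Y => hu.fderiv_fderiv_symm hdet _ _
  have hDP : D (boost l) = 0 := fderiv_self_eq_zero hu hs hdet
  have hdτ : D (tau l) = -(capLam (len l) * D 1) := by
    rw [boost_eq_tau, map_add, map_smul, smul_eq_mul] at hDP
    linarith
  have hk : HasDerivAt (fun s => s ^ 2 * capLam s ^ 3 * γ.A s ^ 2 / 4)
      ((2 * len l * capLam (len l) ^ 3 * γ.A (len l) ^ 2 +
        3 * len l ^ 3 * capLam (len l) * γ.A (len l) ^ 2 +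
        2 * len l ^ 2 * capLam (len l) ^ 3 * γ.A (len l) * deriv γ.A (len l)) / 4) (len l) := by
    have h := ((((hasDerivAt_id (len l)).pow 2).mul ((hasDerivAt_capLam (len l)).pow 3)).mul
      ((γ.differentiableAt_A (len l)).hasDerivAt.pow 2)).div_const 4
    refine h.congr_deriv ?_
    simp only [Pi.pow_apply, Pi.mul_apply, id]
    field_simp
    ring
  have hY : ∑ b, l b • (boost l * pauli b) = boost l * tau l := (boost_mul_tau_eq_sum l).symm
  have hZ : ∑ b, l b • Complex.I • (boost l * pauli b) = Complex.I • (boost l * tau l) := by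
    rw [← hY, Finset.smul_sum]
    exact Finset.sum_congr rfl fun b _ => smul_comm _ _ _
  have hid := trace_identity q hsymm (fun a => boost l * pauli a)
    (fun a => Complex.I • (boost l * pauli a)) l ht rfl (capLam_sq (len l))
    (fun a => Complex.I • (pauli a * boost l)) (fun a => dBoost a l) (fun a => tau (rotVec a l))
    (fun a => by rw [ht]; exact I_smul_pauli_mul_boost l a) (fun a => dBoost_eq l a)
    (fun a => by rw [ht]; exact tau_rotVec_eq l a)
  simp only [hY, hZ] at hid
  have hθθ : ∑ a, thetaD a (thetaD a fun V m => u (V.1 * boost m)) U l = 1 / 4 *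
      ∑ a, q (Complex.I • (pauli a * boost l)) (Complex.I • (pauli a * boost l)) := by
    rw [Finset.mul_sum]
    refine Finset.sum_congr rfl fun a _ => ?_
    rw [hu.thetaD_comp, hu.thetaD_fieldD, hD, hq, gen_mul_gen_mul, map_smul, hDP, gen_mul_boost]
    simp only [map_smul, LinearMap.smul_apply, smul_eq_mul]
    ring
  have hθθl : lamTheta (lamTheta fun V m => u (V.1 * boost m)) U l =
      1 / 4 * q (Complex.I • (boost l * tau l)) (Complex.I • (boost l * tau l)) := by
    rw [hu.lamTheta_comp, hu.lamTheta_fieldD, hD, hq, half_tau_mul_half_tau_mul, map_smul, hDP,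
      half_tau_mul_boost]
    simp only [map_smul, LinearMap.smul_apply, smul_eq_mul]
    ring
  have hang : ∑ a, angularD a (angularD a fun V m => u (V.1 * boost m)) U l =
      ∑ a, q (tau (rotVec a l)) (tau (rotVec a l)) - 2 * D (tau l) := by
    have h := congrArg D (sum_rotVec_rotVec l)
    rw [map_sum, map_smul, smul_eq_mul] at h
    simp only [hu.angularD_comp, hu.angularD_fieldD, hD, hq, Finset.sum_add_distrib, h]
    ring
  have hmix := congrArg D (sum_cross_gen_dBoost l)
  have hlpt : lamPartialTheta (fun V m => u (V.1 * boost m)) U l = 1 / 2 *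
      (l 0 * (q (dBoost 1 l) (Complex.I • (pauli 2 * boost l)) -
          q (dBoost 2 l) (Complex.I • (pauli 1 * boost l))) +
        l 1 * (q (dBoost 2 l) (Complex.I • (pauli 0 * boost l)) -
          q (dBoost 0 l) (Complex.I • (pauli 2 * boost l))) +
        l 2 * (q (dBoost 0 l) (Complex.I • (pauli 1 * boost l)) -
          q (dBoost 1 l) (Complex.I • (pauli 0 * boost l)))) + D (tau l) := by
    rw [← hmix]
    simp only [lamPartialTheta, hu.partialD_thetaD_comp, hD, hq, gen_mul_boost, map_smul,
      map_add, map_sub, smul_eq_mul, dotProduct, Fin.sum_univ_three, Matrix.cons_val_zero,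
      Matrix.cons_val_one, Matrix.cons_val]
    ring
  have hray : D (rayVelocity ((len l)⁻¹ • l) (len l)) =
      len l / capLam (len l) * D 1 + D (tau l) / len l := by
    rw [rayVelocity, map_add, map_smul, tau_smul, map_smul, smul_eq_mul, smul_eq_mul]
    ring
  have hrad := hu.radialD_radialD U hl hk
  simp only [hD, hq, hray] at hrad
  rw [rayVelocity_eq hl] at hrad
  simp only [map_smul, LinearMap.smul_apply, smul_eq_mul] at hrad
  rw [hK.lapAt_polar hG u U hl q (fun X Y => rfl) hsymm, lapFormula]
  simp only [hθθ, hθθl, hang, hlpt, hrad]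
  have := scalar_identity hlen.ne' hcap.ne' (γ.A_pos (len l)).ne'
    (hK.coeffB_pos hG hlen.ne').ne' (capLam_sq (len l)) rfl hdτ hid
  rw [this]
  ring

/-! ### Continuity of the Laplacian -/

/-- Only the inverse Gram matrix and the Hessian of `u` occur, so continuity holds also where the
polar formula is singular. -/
theorem continuousAt_lapAt (γ : RatMetric) {u : Mat2 → ℝ} (hu : IsCnOnGL 2 u) {L : Mat2}
    (hL : L.det ≠ 0) : ContinuousAt (γ.lapAt u) L := by
  have hmul : ∀ i, Differentiable ℝ fun M : Mat2 => M * chartDir i := fun i =>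
    (LinearMap.toContinuousLinearMap (LinearMap.mulRight ℝ (chartDir i))).differentiable
  have hgram : ∀ i j, DifferentiableAt ℝ (fun M => γ.gram M i j) L := fun i j =>
    ((γ.differentiableAt_form hL).clm_apply (hmul i L)).clm_apply (hmul j L)
  have hinv := differentiableAt_matrix_inv hgram (γ.gram_posDef hL).det_pos.ne'
  refine ContinuousAt.neg (tendsto_finsetSum _ fun i _ => tendsto_finsetSum _ fun j _ => ?_)
  exact (hinv i j).continuousAt.mul (((hu.continuousAt_fderiv_fderiv hL).clm_apply
    (hmul i L).continuousAt).clm_apply (hmul j L).continuousAt)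

end RatMetric

theorem continuous_boost : Continuous boost := by
  have hd : Continuous fun l : Fin 3 → ℝ => l ⬝ᵥ l := by
    simp only [dotProduct]
    fun_prop
  have h : boost = fun l => √(1 + l ⬝ᵥ l) • (1 : Mat2) + tau l := by
    funext l
    rw [boost_eq_tau, capLam_len]
  rw [h]
  have h1 : Continuous fun l : Fin 3 → ℝ => √(1 + l ⬝ᵥ l) := (continuous_const.add hd).sqrt
  exact (h1.smul continuous_const).add
    (continuous_finsetSum _ fun a _ => (continuous_apply a).smul continuous_const)

/-! ### The formula on `Rat1` and its limit at the origin -/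

theorem pullback_comp_polar (f : Rat1 → ℝ) :
    (fun (V : SU2) m => f (polar V m)) = fun V m => Rat1.pullback f (V.1 * boost m) := by
  funext V m
  rw [Rat1.pullback_of_det_ne_zero f (det_polar V m)]
  rfl

theorem mainTheorem3 (γ : RatMetric) (hK : γ.IsKahler) (hG : γ.IsInvariant)
    (f : Rat1 → ℝ) (hf : Rat1.IsCn 2 f) (U : SU2) :
    (∀ l : Fin 3 → ℝ, l ≠ 0 →
      γ.laplacian f (polar U l) = lapFormula γ.A (fun V m => f (polar V m)) U l) ∧
    Tendsto (fun l : Fin 3 → ℝ => lapFormula γ.A (fun V m => f (polar V m)) U l)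
      (𝓝[≠] 0) (𝓝 (γ.laplacian f (polar U 0))) := by
  have hlap : ∀ l, γ.laplacian f (polar U l) = γ.lapAt (Rat1.pullback f) (U.1 * boost l) :=
    fun l => hK.laplacian_ofMatrix hf (det_polar U l)
  have hformula : ∀ l, l ≠ 0 → γ.lapAt (Rat1.pullback f) (U.1 * boost l) =
      lapFormula γ.A (fun V m => f (polar V m)) U l := fun l hl => by
    rw [pullback_comp_polar]
    exact hK.lapAt_eq_lapFormula hG hf (fun L c hc => Rat1.pullback_smul f L hc) U hl
  refine ⟨fun l hl => (hlap l).trans (hformula l hl), ?_⟩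
  rw [hlap 0]
  have hc : ContinuousAt (fun l => U.1 * boost l) 0 :=
    ((LinearMap.toContinuousLinearMap (LinearMap.mulLeft ℝ U.1)).continuous.comp
      continuous_boost).continuousAt
  -- The singular coefficients are never estimated: off the origin the formula equals the continuous
  -- function `lapAt`, whose limit is its value.
  have h : Tendsto (fun l => γ.lapAt (Rat1.pullback f) (U.1 * boost l)) (𝓝[≠] 0)
      (𝓝 (γ.lapAt (Rat1.pullback f) (U.1 * boost 0))) :=
    ((γ.continuousAt_lapAt hf (det_polar U 0)).tendsto.comp hc.tendsto).mono_left
      nhdsWithin_le_nhds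
  refine h.congr' ?_
  filter_upwards [self_mem_nhdsWithin] with l hl using hformula l hl

end
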